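/- **Setting.** Let $\Omega\subset\mathbb R^3$ be a bounded open polyhedral domain with a conforming triangulation $\mathcal T_h$ into finitely many nondegenerate tetrahedra, let $r,s\ge 0$ be integers, let $\mu,\lambda,\nu$ be the (real) viscosity and resistivity coefficients, and let $\langle\cdot,\cdot\rangle$ be the $L^2(\Omega)$ inner product. Let $$U_h^{\mathrm{grad}}=\{u\in H^1_0(\Omega)^3: u|_K\in P_{r+1}(K)^3\},\qquad U_h^{\mathrm{curl}}=\{u\in H_0(\mathrm{curl},\Omega): u|_K\in P_r(K)^3+x\times P_r(K)^3\},$$ $$U_h^{\mathrm{div}}=\{u\in H_0(\mathrm{div},\Omega): u|_K\in P_r(K)^3+xP_r(K)\},\qquad F_h=\{f\in L^2(\Omega): f|_K\in P_s(K)\}$$ (conditions for all $K\in\mathcal T_h$) be the Lagrange, Nédélec, Raviart–Thomas and discontinuous Galerkin spaces. Let $\pi_h^{\mathrm{div}}$ be the $L^2$-orthogonal projector onto $U_h^{\mathrm{div}}$, and define $\operatorname{curl}_h u\in U_h^{\mathrm{curl}}$ by $\langle \operatorname{curl}_h u,v\rangle=\langle u,\operatorname{curl}v\rangle$ for all $v\in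 U_h^{\mathrm{curl}}$. Put $$a(w,u,v)=-\int_\Omega w\cdot[u,v]\,dx,\quad [u,v]=u\cdot\nabla v-v\cdot\nabla u,\qquad d(u,v)=-\int_\Omega\big[\mu\nabla u:\nabla v+(\lambda+\mu)\operatorname{div}u\operatorname{div}v\big]dx,$$ $$b_h(f,g,u)=-\sum_{K}\int_K (u\cdot\nabla f)\,g\,dx+\sum_{e}\int_e u\cdot[\![f]\!]\{g\}\,ds,\qquad e_h(B,C)=-\nu\langle\operatorname{curl}_hB,\operatorname{curl}_hC\rangle,$$ where $e$ runs over the interior faces $e=K_1\cap K_2$, $[\![f]\!]=f_1n_1+f_2n_2$ with $f_i=f|_{K_i}$, $n_1$ the unit normal of $e$ pointing from $K_1$ to $K_2$ and $n_2=-n_1$, and $\{g\}=(g_1+g_2)/2$. Let $\ell(u,\rho,B)$ be a Lagrangian on $U_h^{\mathrm{grad}}\times F_h\times U_h^{\mathrm{div}}$ that is differentiable at all states of a set of admissible states, with functional derivatives $\frac{\delta\ell}{\delta u},\frac{\delta\ell}{\delta B}\in L^2(\Omega)^3$ and $\frac{\delta\ell}{\delta\rho}\in L^2(\Omega)$ there,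 i.e. $D\ell(u,\rho,B)[\delta u,\delta\rho,\delta B]=\langle\frac{\delta\ell}{\delta u},\delta u\rangle+\langle\frac{\delta\ell}{\delta\rho},\delta\rho\rangle+\langle\frac{\delta\ell}{\delta B},\delta B\rangle$ for all discrete variations. **Scheme.** On a time interval $[0,T]$, $T>0$, let $u,w:[0,T]\to U_h^{\mathrm{grad}}$, $\rho,\theta:[0,T]\to F_h$, $B:[0,T]\to U_h^{\mathrm{div}}$ and $J,H,U,E,\alpha,j:[0,T]\to U_h^{\mathrm{curl}}$, with $u,\rho,B$ (and $\langle\frac{\delta\ell}{\delta u},v\rangle$ for each $v\in U_h^{\mathrm{grad}}$) differentiable in time and $(u,\rho,B)$ admissible, satisfy for all $t\in[0,T]$ $$\begin{aligned} \langle\partial_t\tfrac{\delta\ell}{\delta u},v\rangle+a(w,u,v)+b_h(\theta,\rho,v)+\langle\alpha,v\rangle&=d(u,v)&&\forall v\in U_h^{\mathrm{grad}},\\ \langle\partial_t\rho,\sigma\rangle+b_h(\sigma,\rho,u)&=0&&\forall\sigma\in F_h,\\ \langle\partial_tB,C\rangle+\langle\operatorname{curl}E,C\rangle&=-\nu\langle\operatorname{curl}j,C\rangle&&\forall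 C\in U_h^{\mathrm{div}},\\ \langle w,z\rangle=\langle\tfrac{\delta\ell}{\delta u},z\rangle\ \ \forall z\in U_h^{\mathrm{grad}},\qquad\langle\theta,\tau\rangle&=\langle\tfrac{\delta\ell}{\delta\rho},\tau\rangle&&\forall\tau\in F_h,\\ \langle J,K\rangle=-\langle\tfrac{\delta\ell}{\delta B},\operatorname{curl}K\rangle,\qquad\langle j,K\rangle&=\langle B,\operatorname{curl}K\rangle&&\forall K\in U_h^{\mathrm{curl}},\\ \langle H,G\rangle=\langle B,G\rangle,\qquad\langle U,G\rangle&=\langle u,G\rangle&&\forall G\in U_h^{\mathrm{curl}},\\ \langle E,F\rangle=-\langle U\times H,F\rangle,\qquad\langle\alpha,F\rangle&=-\langle J\times H,F\rangle&&\forall F\in U_h^{\mathrm{curl}}. \end{aligned}$$ **Proposition.** If $\operatorname{div}B(0)=0$, then for all $t\in[0,T]$ $$\operatorname{div}B(t)=0,\qquad \frac{d}{dt}\int_\Omega\rho\,dx=0,\qquad \frac{d}{dt}\mathcal E=d(u,u)-e_h\Big(B,\pi_h^{\mathrm{div}}\frac{\delta\ell}{\delta B}\Big),\qquad \frac{d}{dt}\int_\Omega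 A\cdot B\,dx=2\,e_h(B,\pi_h^{\mathrm{div}}A).$$ Here $\mathcal E=\langle\frac{\delta\ell}{\delta u},u\rangle-\ell(u,\rho,B)$ is the total energy, and $A=A(t)\in L^2(\Omega)^3$ is any family of vector fields with $\operatorname{curl}A(t)=B(t)$ and $A(t)\times n|_{\partial\Omega}=0$ for all $t\in[0,T]$. (At $t=0$ and $t=T$ the time derivatives are one-sided.) -/

import Mathlib

open MeasureTheory Set
open scoped ContDiff

noncomputable section

namespace MHD

/-! ### Fields on a domain of `ℝ³` and Sobolev-type spaces -/

/-- Euclidean three-space. -/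
abbrev E3 : Type := EuclideanSpace ℝ (Fin 3)

/-- The scalar fields `L²(Ω)`. -/
abbrev L2s (Ω : Set E3) : Type := Lp ℝ 2 (volume.restrict Ω)

/-- The vector fields `L²(Ω)³`. -/
abbrev L2v (Ω : Set E3) : Type := Lp E3 2 (volume.restrict Ω)

/-- The `i`-th component of a vector field. -/
def comp {Ω : Set E3} (i : Fin 3) : L2v Ω →L[ℝ] L2s Ω :=
  (EuclideanSpace.proj i : E3 →L[ℝ] ℝ).compLpL 2 (volume.restrict Ω)

/-- Cross product of vectors of `ℝ³`. -/
def cross (x y : E3) : E3 :=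
  !₂[x 1 * y 2 - x 2 * y 1, x 2 * y 0 - x 0 * y 2, x 0 * y 1 - x 1 * y 0]

/-- The classical partial derivative `∂ⱼ φᵢ`. -/
def pd (φ : E3 → E3) (i j : Fin 3) (x : E3) : ℝ :=
  fderiv ℝ φ x (EuclideanSpace.single j 1) i

/-- The classical curl. -/
def ccurl (φ : E3 → E3) (x : E3) : E3 :=
  !₂[pd φ 2 1 x - pd φ 1 2 x, pd φ 0 2 x - pd φ 2 0 x, pd φ 1 0 x - pd φ 0 1 x]

/-- The classical divergence. -/
def cdiv (φ : E3 → E3) (x : E3) : ℝ := ∑ i, pd φ i i x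

/-- Smooth functions with compact support in `Ω`. -/
structure IsTest {F : Type*} [NormedAddCommGroup F] [NormedSpace ℝ F]
    (Ω : Set E3) (φ : E3 → F) : Prop where
  smooth : ContDiff ℝ ∞ φ
  compact : HasCompactSupport φ
  supp : tsupport φ ⊆ Ω

/-- `f ∈ H¹(Ω)` with weak gradient `G`. -/
def HasWeakGrad {Ω : Set E3} (f : L2s Ω) (G : L2v Ω) : Prop :=
  ∀ φ : E3 → E3, IsTest Ω φ →
    ∫ x in Ω, inner ℝ (G x) (φ x) = - ∫ x in Ω, f x * cdiv φ x

/-- `u ∈ H(curl, Ω)` with weak curl `w`. -/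
def HasWeakCurl {Ω : Set E3} (u w : L2v Ω) : Prop :=
  ∀ φ : E3 → E3, IsTest Ω φ →
    ∫ x in Ω, inner ℝ (w x) (φ x) = ∫ x in Ω, inner ℝ (u x) (ccurl φ x)

/-- `u ∈ H(div, Ω)` with weak divergence `g`. -/
def HasWeakDiv {Ω : Set E3} (u : L2v Ω) (g : L2s Ω) : Prop :=
  ∀ φ : E3 → ℝ, IsTest Ω φ →
    ∫ x in Ω, g x * φ x = - ∫ x in Ω, inner ℝ (u x) (gradient φ x)

/-- `f ∈ H¹₀(Ω)` with gradient `G`: the boundary condition `f = 0` on `∂Ω` holds in the weak sense,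
i.e. Green's formula against all fields of `H(div, Ω)` has no boundary term. -/
def HasGrad0 {Ω : Set E3} (f : L2s Ω) (G : L2v Ω) : Prop :=
  HasWeakGrad f G ∧
    ∀ (v : L2v Ω) (g : L2s Ω), HasWeakDiv v g → inner ℝ G v = - inner ℝ f g

/-- `u ∈ H₀(curl, Ω)` with curl `w`: the boundary condition `u × n = 0` on `∂Ω` holds in the weak
sense, i.e. Green's formula against all fields of `H(curl, Ω)` has no boundary term. -/
def HasCurl0 {Ω : Set E3} (u w : L2v Ω) : Prop :=
  HasWeakCurl u w ∧
    ∀ v z : L2v Ω, HasWeakCurl v z → inner ℝ w v = inner ℝ u z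

/-- `u ∈ H₀(div, Ω)` with divergence `g`: the boundary condition `u · n = 0` on `∂Ω` holds in the
weak sense, i.e. Green's formula against all functions of `H¹(Ω)` has no boundary term. -/
def HasDiv0 {Ω : Set E3} (u : L2v Ω) (g : L2s Ω) : Prop :=
  HasWeakDiv u g ∧
    ∀ (f : L2s Ω) (G : L2v Ω), HasWeakGrad f G → inner ℝ g f = - inner ℝ u G

open Classical in
/-- The gradient on `H¹₀(Ω)` (set to zero outside this space). -/
def grad {Ω : Set E3} (f : L2s Ω) : L2v Ω :=
  if h : ∃ G, HasGrad0 f G then h.choose else 0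

open Classical in
/-- The curl on `H₀(curl, Ω)` (set to zero outside this space). -/
def curl {Ω : Set E3} (u : L2v Ω) : L2v Ω :=
  if h : ∃ w, HasCurl0 u w then h.choose else 0

/-! Linearity of the weak derivatives. -/

theorem IsTest.memLp {F : Type*} [NormedAddCommGroup F] [NormedSpace ℝ F]
    {Ω : Set E3} {φ : E3 → F} (h : IsTest Ω φ) : MemLp φ 2 (volume.restrict Ω) :=
  (h.smooth.continuous.memLp_of_hasCompactSupport h.compact).restrict Ω

theorem integrable_inner_of_memLp {Ω : Set E3} (u : L2v Ω) {φ : E3 → E3}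
    (h : MemLp φ 2 (volume.restrict Ω)) :
    Integrable (fun x => inner ℝ (u x) (φ x)) (volume.restrict Ω) := by
  refine (L2.integrable_inner (𝕜 := ℝ) u h.toLp).congr ?_
  filter_upwards [h.coeFn_toLp] with x hx
  rw [hx]

theorem integrable_mul_of_memLp {Ω : Set E3} (f : L2s Ω) {φ : E3 → ℝ}
    (h : MemLp φ 2 (volume.restrict Ω)) :
    Integrable (fun x => f x * φ x) (volume.restrict Ω) :=
  (Lp.memLp f).integrable_mul h

theorem pd_cont {Ω : Set E3} {φ : E3 → E3} (h : IsTest Ω φ) (i j : Fin 3) :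
    Continuous (pd φ i j) := by
  have h1 : Continuous (fderiv ℝ φ) := h.smooth.continuous_fderiv (by simp)
  have h2 : Continuous fun x => fderiv ℝ φ x (EuclideanSpace.single j (1 : ℝ)) :=
    h1.clm_apply continuous_const
  exact (EuclideanSpace.proj i : E3 →L[ℝ] ℝ).continuous.comp h2

theorem fderiv_eq_zero_of_notMem {F : Type*} [NormedAddCommGroup F] [NormedSpace ℝ F]
    {φ : E3 → F} {x : E3} (hx : x ∉ tsupport φ) : fderiv ℝ φ x = 0 := by
  by_contra hne
  exact hx (support_fderiv_subset ℝ (f := φ) hne)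

theorem IsTest.ccurl_memLp {Ω : Set E3} {φ : E3 → E3} (h : IsTest Ω φ) :
    MemLp (ccurl φ) 2 (volume.restrict Ω) := by
  have hc : Continuous (ccurl φ) := by
    have := fun i j => pd_cont h i j
    refine (PiLp.continuous_toLp 2 _).comp (continuous_pi fun i => ?_)
    fin_cases i
    · exact (this 2 1).sub (this 1 2)
    · exact (this 0 2).sub (this 2 0)
    · exact (this 1 0).sub (this 0 1)
  refine (hc.memLp_of_hasCompactSupport ?_).restrict Ω
  refine HasCompactSupport.intro h.compact fun x hx => ?_
  ext i
  fin_cases i <;> simp [ccurl, pd, fderiv_eq_zero_of_notMem hx]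

theorem IsTest.cdiv_memLp {Ω : Set E3} {φ : E3 → E3} (h : IsTest Ω φ) :
    MemLp (cdiv φ) 2 (volume.restrict Ω) := by
  have hc : Continuous (cdiv φ) := continuous_finsetSum _ fun i _ => pd_cont h i i
  refine (hc.memLp_of_hasCompactSupport ?_).restrict Ω
  refine HasCompactSupport.intro h.compact fun x hx => ?_
  simp [cdiv, pd, fderiv_eq_zero_of_notMem hx]

theorem IsTest.gradient_memLp {Ω : Set E3} {φ : E3 → ℝ} (h : IsTest Ω φ) :
    MemLp (gradient φ) 2 (volume.restrict Ω) := by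
  have hc : Continuous (gradient φ) :=
    (InnerProductSpace.toDual ℝ E3).symm.continuous.comp
      (h.smooth.continuous_fderiv (by simp))
  refine (hc.memLp_of_hasCompactSupport ?_).restrict Ω
  refine HasCompactSupport.intro h.compact fun x hx => ?_
  simp [gradient, fderiv_eq_zero_of_notMem hx]

theorem integral_inner_lin {Ω : Set E3} (a : ℝ) (u v : L2v Ω) {φ : E3 → E3}
    (h : MemLp φ 2 (volume.restrict Ω)) :
    ∫ x in Ω, inner ℝ ((a • u + v : L2v Ω) x) (φ x) =
      a * (∫ x in Ω, inner ℝ (u x) (φ x)) + ∫ x in Ω, inner ℝ (v x) (φ x) := by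
  rw [← integral_const_mul, ← integral_add ((integrable_inner_of_memLp u h).const_mul a)
    (integrable_inner_of_memLp v h)]
  refine integral_congr_ae ?_
  filter_upwards [Lp.coeFn_add (a • u) v, Lp.coeFn_smul a u] with x h1 h2
  rw [h1, Pi.add_apply, h2, Pi.smul_apply, inner_add_left, real_inner_smul_left]

theorem integral_mul_lin {Ω : Set E3} (a : ℝ) (u v : L2s Ω) {φ : E3 → ℝ}
    (h : MemLp φ 2 (volume.restrict Ω)) :
    ∫ x in Ω, (a • u + v : L2s Ω) x * φ x =
      a * (∫ x in Ω, u x * φ x) + ∫ x in Ω, v x * φ x := by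
  rw [← integral_const_mul, ← integral_add ((integrable_mul_of_memLp u h).const_mul a)
    (integrable_mul_of_memLp v h)]
  refine integral_congr_ae ?_
  filter_upwards [Lp.coeFn_add (a • u) v, Lp.coeFn_smul a u] with x h1 h2
  rw [h1, Pi.add_apply, h2, Pi.smul_apply, smul_eq_mul]
  ring

theorem HasGrad0.lin {Ω : Set E3} {f g : L2s Ω} {F G : L2v Ω} (a : ℝ)
    (h1 : HasGrad0 f F) (h2 : HasGrad0 g G) : HasGrad0 (a • f + g) (a • F + G) := by
  refine ⟨fun φ hφ => ?_, fun v k hv => ?_⟩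
  · rw [integral_inner_lin a F G hφ.memLp, integral_mul_lin a f g hφ.cdiv_memLp,
      h1.1 φ hφ, h2.1 φ hφ]
    ring
  · rw [inner_add_left, inner_add_left, real_inner_smul_left, real_inner_smul_left,
      h1.2 v k hv, h2.2 v k hv]
    ring

theorem HasCurl0.lin {Ω : Set E3} {f g : L2v Ω} {F G : L2v Ω} (a : ℝ)
    (h1 : HasCurl0 f F) (h2 : HasCurl0 g G) : HasCurl0 (a • f + g) (a • F + G) := by
  refine ⟨fun φ hφ => ?_, fun v k hv => ?_⟩
  · rw [integral_inner_lin a F G hφ.memLp, integral_inner_lin a f g hφ.ccurl_memLp,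
      h1.1 φ hφ, h2.1 φ hφ]
  · rw [inner_add_left, inner_add_left, real_inner_smul_left, real_inner_smul_left,
      h1.2 v k hv, h2.2 v k hv]

theorem HasDiv0.lin {Ω : Set E3} {f g : L2v Ω} {F G : L2s Ω} (a : ℝ)
    (h1 : HasDiv0 f F) (h2 : HasDiv0 g G) : HasDiv0 (a • f + g) (a • F + G) := by
  refine ⟨fun φ hφ => ?_, fun v k hv => ?_⟩
  · rw [integral_mul_lin a F G hφ.memLp, integral_inner_lin a f g hφ.gradient_memLp,
      h1.1 φ hφ, h2.1 φ hφ]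
    ring
  · rw [inner_add_left, inner_add_left, real_inner_smul_left, real_inner_smul_left,
      h1.2 v k hv, h2.2 v k hv]
    ring

theorem HasGrad0.zero {Ω : Set E3} : HasGrad0 (0 : L2s Ω) 0 := by
  refine ⟨fun φ hφ => ?_, fun v k hv => by simp⟩
  have h := integral_inner_lin (-1) (0 : L2v Ω) 0 hφ.memLp
  have h' := integral_mul_lin (-1) (0 : L2s Ω) 0 hφ.cdiv_memLp
  simp only [smul_zero, add_zero] at h h'
  linarith

theorem HasCurl0.zero {Ω : Set E3} : HasCurl0 (0 : L2v Ω) 0 := by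
  refine ⟨fun φ hφ => ?_, fun v k hv => by simp⟩
  have h := integral_inner_lin (-1) (0 : L2v Ω) 0 hφ.memLp
  have h' := integral_inner_lin (-1) (0 : L2v Ω) 0 hφ.ccurl_memLp
  simp only [smul_zero, add_zero] at h h'
  linarith

theorem HasDiv0.zero {Ω : Set E3} : HasDiv0 (0 : L2v Ω) 0 := by
  refine ⟨fun φ hφ => ?_, fun v k hv => by simp⟩
  have h := integral_mul_lin (-1) (0 : L2s Ω) 0 hφ.memLp
  have h' := integral_inner_lin (-1) (0 : L2v Ω) 0 hφ.gradient_memLp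
  simp only [smul_zero, add_zero] at h h'
  linarith

/-- A subset of a real vector space that contains zero and is stable under `a • f + g`. -/
def mkSubmodule {M : Type*} [AddCommGroup M] [Module ℝ M] (S : Set M) (h0 : (0 : M) ∈ S)
    (hl : ∀ (a : ℝ) (f g : M), f ∈ S → g ∈ S → a • f + g ∈ S) : Submodule ℝ M where
  carrier := S
  zero_mem' := h0
  add_mem' := fun {f g} hf hg => by simpa using hl 1 f g hf hg
  smul_mem' := fun a f hf => by simpa using hl a f 0 hf h0

/-- `H¹₀(Ω)`. -/
def H10 (Ω : Set E3) : Submodule ℝ (L2s Ω) :=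
  mkSubmodule {f | ∃ G, HasGrad0 f G} ⟨0, HasGrad0.zero⟩
    fun a _ _ ⟨F, hF⟩ ⟨G, hG⟩ => ⟨a • F + G, hF.lin a hG⟩

/-- `H₀(curl, Ω)`. -/
def H0curl (Ω : Set E3) : Submodule ℝ (L2v Ω) :=
  mkSubmodule {u | ∃ w, HasCurl0 u w} ⟨0, HasCurl0.zero⟩
    fun a _ _ ⟨F, hF⟩ ⟨G, hG⟩ => ⟨a • F + G, hF.lin a hG⟩

/-- `H₀(div, Ω)`. -/
def H0div (Ω : Set E3) : Submodule ℝ (L2v Ω) :=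
  mkSubmodule {u | ∃ g, HasDiv0 u g} ⟨0, HasDiv0.zero⟩
    fun a _ _ ⟨F, hF⟩ ⟨G, hG⟩ => ⟨a • F + G, hF.lin a hG⟩

/-! Uniqueness of the weak derivatives on an open set. -/

theorem scalar_eq_zero {Ω : Set E3} (hΩ : IsOpen Ω) (f : L2s Ω)
    (h : ∀ φ : E3 → ℝ, IsTest Ω φ → ∫ x in Ω, f x * φ x = 0) : f = 0 := by
  have hf : LocallyIntegrableOn (f : E3 → ℝ) Ω volume := by
    intro x hx
    obtain ⟨ε, hε, hb⟩ := Metric.isOpen_iff.1 hΩ x hx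
    refine ⟨Metric.ball x ε, mem_nhdsWithin_of_mem_nhds (Metric.ball_mem_nhds x hε), ?_⟩
    have h2 : MemLp (f : E3 → ℝ) 2 (volume.restrict (Metric.ball x ε)) :=
      (Lp.memLp f).mono_measure (Measure.restrict_mono hb le_rfl)
    have : IsFiniteMeasure (volume.restrict (Metric.ball x ε)) :=
      ⟨by simpa using (measure_ball_lt_top (μ := (volume : Measure E3)) (x := x) (r := ε))⟩
    exact h2.integrable (by norm_num)
  have key := hΩ.ae_eq_zero_of_integral_contDiff_smul_eq_zero hf fun g hg hc hs => by
    have h1 := h g ⟨hg, hc, hs⟩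
    rw [← h1, ← integral_indicator hΩ.measurableSet]
    refine integral_congr_ae (Filter.Eventually.of_forall fun x => ?_)
    by_cases hx : x ∈ Ω
    · simp [hx, mul_comm]
    · have : g x = 0 := image_eq_zero_of_notMem_tsupport fun hx' => hx (hs hx')
      simp [hx, this]
  rw [Lp.eq_zero_iff_ae_eq_zero]
  exact (ae_restrict_iff' hΩ.measurableSet).2 key

theorem vector_eq_zero {Ω : Set E3} (hΩ : IsOpen Ω) (u : L2v Ω)
    (h : ∀ φ : E3 → E3, IsTest Ω φ → ∫ x in Ω, inner ℝ (u x) (φ x) = 0) : u = 0 := by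
  have hc : ∀ i, comp i u = 0 := fun i => by
    refine scalar_eq_zero hΩ _ fun φ hφ => ?_
    have ht : IsTest Ω (fun x => φ x • (EuclideanSpace.single i (1 : ℝ) : E3)) :=
      ⟨hφ.smooth.smul contDiff_const, hφ.compact.smul_right,
        (tsupport_smul_subset_left φ _).trans hφ.supp⟩
    rw [← h _ ht]
    refine integral_congr_ae ?_
    filter_upwards [ContinuousLinearMap.coeFn_compLpL (EuclideanSpace.proj i : E3 →L[ℝ] ℝ) u]
      with x hx
    have hx' : comp i u x = u x i := hx
    rw [hx', real_inner_smul_right, EuclideanSpace.inner_single_right]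
    simp [mul_comm]
  rw [Lp.eq_zero_iff_ae_eq_zero]
  have h1 : ∀ᵐ x ∂volume.restrict Ω, ∀ i, u x i = 0 := by
    rw [ae_all_iff]
    intro i
    filter_upwards [ContinuousLinearMap.coeFn_compLpL (EuclideanSpace.proj i : E3 →L[ℝ] ℝ) u,
      (Lp.eq_zero_iff_ae_eq_zero (f := comp i u)).1 (hc i)] with x hx hx0
    have hx' : comp i u x = u x i := hx
    rw [← hx', hx0]
    rfl
  filter_upwards [h1] with x hx
  ext i
  simpa using hx i

theorem HasCurl0.unique {Ω : Set E3} (hΩ : IsOpen Ω) {u w w' : L2v Ω}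
    (h : HasCurl0 u w) (h' : HasCurl0 u w') : w = w' := by
  have h0 : HasCurl0 ((-1 : ℝ) • u + u) ((-1 : ℝ) • w + w') := h.lin (-1) h'
  have h1 : (-1 : ℝ) • u + u = 0 := by simp
  rw [h1] at h0
  have h2 : (-1 : ℝ) • w + w' = 0 := vector_eq_zero hΩ _ fun φ hφ => by
    rw [h0.1 φ hφ, ← HasCurl0.zero.1 φ hφ]
    have := integral_inner_lin (-1) (0 : L2v Ω) 0 hφ.memLp
    simp only [smul_zero, add_zero] at this
    linarith
  have h3 : w' - w = 0 := by rw [← h2]; module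
  exact (sub_eq_zero.1 h3).symm

theorem HasGrad0.unique {Ω : Set E3} (hΩ : IsOpen Ω) {f : L2s Ω} {w w' : L2v Ω}
    (h : HasGrad0 f w) (h' : HasGrad0 f w') : w = w' := by
  have h0 : HasGrad0 ((-1 : ℝ) • f + f) ((-1 : ℝ) • w + w') := h.lin (-1) h'
  have h1 : (-1 : ℝ) • f + f = 0 := by simp
  rw [h1] at h0
  have h2 : (-1 : ℝ) • w + w' = 0 := vector_eq_zero hΩ _ fun φ hφ => by
    rw [h0.1 φ hφ, ← HasGrad0.zero.1 φ hφ]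
    have := integral_inner_lin (-1) (0 : L2v Ω) 0 hφ.memLp
    simp only [smul_zero, add_zero] at this
    linarith
  have h3 : w' - w = 0 := by rw [← h2]; module
  exact (sub_eq_zero.1 h3).symm

theorem hasGrad0_grad {Ω : Set E3} {f : L2s Ω} (h : f ∈ H10 Ω) : HasGrad0 f (grad f) := by
  have h' : ∃ G, HasGrad0 f G := h
  rw [grad, dif_pos h']
  exact h'.choose_spec

theorem hasCurl0_curl {Ω : Set E3} {u : L2v Ω} (h : u ∈ H0curl Ω) : HasCurl0 u (curl u) := by
  have h' : ∃ w, HasCurl0 u w := h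
  rw [curl, dif_pos h']
  exact h'.choose_spec

/-! ### Triangulations -/

/-- A (conforming, finite) triangulation of `Ω` into nondegenerate tetrahedra: a finite simplicial
complex in which every face lies in a tetrahedron, and which fills up `Ω`. -/
structure Triangulation (Ω : Set E3) extends Geometry.SimplicialComplex ℝ E3 where
  finite : faces.Finite
  pure : ∀ s ∈ faces, ∃ K ∈ faces, s ⊆ K ∧ K.card = 4
  fills : interior toSimplicialComplex.space = Ω

variable {Ω : Set E3}

theorem Triangulation.isOpen (T : Triangulation Ω) : IsOpen Ω := T.fills ▸ isOpen_interior

/-- The tetrahedra (given by their sets of vertices). -/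
def Triangulation.cells (T : Triangulation Ω) : Finset (Finset E3) :=
  (T.finite.subset (sep_subset T.faces fun K => K.card = 4)).toFinset

theorem Triangulation.exists_cell (T : Triangulation Ω) {x : E3} (hx : x ∈ Ω) :
    ∃ K ∈ T.cells, x ∈ convexHull ℝ (K : Set E3) := by
  rw [← T.fills] at hx
  obtain ⟨s, hs, hxs⟩ := Geometry.SimplicialComplex.mem_space_iff.1 (interior_subset hx)
  obtain ⟨K, hK, hsK, hc⟩ := T.pure s hs
  exact ⟨K, by simp [cells, hK, hc], convexHull_mono (by exact_mod_cast hsK) hxs⟩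

/-! ### Polynomial spaces and finite element spaces -/

/-- Polynomials in three variables. -/
abbrev Poly : Type := MvPolynomial (Fin 3) ℝ

/-- Polynomial vector fields. -/
abbrev VPoly : Type := Fin 3 → Poly

/-- Value of a polynomial at a point. -/
def Poly.val (p : Poly) (x : E3) : ℝ := MvPolynomial.eval (fun i => x i) p

/-- Value of a polynomial vector field at a point. -/
def VPoly.val (p : VPoly) (x : E3) : E3 := WithLp.toLp 2 fun i => Poly.val (p i) x

/-- `P_r`: polynomials of (total) degree at most `r`. -/
def P (r : ℕ) : Submodule ℝ Poly := MvPolynomial.restrictTotalDegree (Fin 3) ℝ r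

/-- `P_r³`. -/
def PV (r : ℕ) : Submodule ℝ VPoly := Submodule.pi univ fun _ => P r

/-- The map `q ↦ x q`. -/
def mulX : Poly →ₗ[ℝ] VPoly :=
  LinearMap.pi fun i => LinearMap.mulLeft ℝ (MvPolynomial.X i)

/-- The map `q ↦ x × q`. -/
def crossX : VPoly →ₗ[ℝ] VPoly where
  toFun q := ![MvPolynomial.X 1 * q 2 - MvPolynomial.X 2 * q 1,
    MvPolynomial.X 2 * q 0 - MvPolynomial.X 0 * q 2,
    MvPolynomial.X 0 * q 1 - MvPolynomial.X 1 * q 0]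
  map_add' p q := by
    funext i
    fin_cases i <;> simp <;> ring
  map_smul' a q := by
    funext i
    fin_cases i <;> simp [smul_sub]

/-- The local Raviart–Thomas space `P_r³ + x P_r`. -/
def RTloc (r : ℕ) : Submodule ℝ VPoly := PV r ⊔ (P r).map mulX

/-- The local Nédélec space of the first kind `P_r³ + x × P_r³`. -/
def NEDloc (r : ℕ) : Submodule ℝ VPoly := PV r ⊔ (PV r).map crossX

instance (r : ℕ) : FiniteDimensional ℝ (P r) :=
  inferInstanceAs (Module.Finite ℝ (MvPolynomial.restrictTotalDegree (Fin 3) ℝ r))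

instance (r : ℕ) : FiniteDimensional ℝ (PV r) := by
  let f : PV r →ₗ[ℝ] (Fin 3 → P r) :=
    { toFun := fun p i => ⟨p.1 i, p.2 i (mem_univ i)⟩
      map_add' := fun _ _ => rfl
      map_smul' := fun _ _ => rfl }
  refine FiniteDimensional.of_injective f fun p q h => ?_
  ext1
  funext i
  exact congrArg Subtype.val (congrFun h i)

instance (r : ℕ) : FiniteDimensional ℝ (RTloc r) :=
  inferInstanceAs (FiniteDimensional ℝ ↥(PV r ⊔ (P r).map mulX))

instance (r : ℕ) : FiniteDimensional ℝ (NEDloc r) :=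
  inferInstanceAs (FiniteDimensional ℝ ↥(PV r ⊔ (PV r).map crossX))

/-- `f|_K = p` almost everywhere on the tetrahedron `K`. -/
def EqOnCell {F : Type*} (f g : E3 → F) (Ω : Set E3) (K : Finset E3) : Prop :=
  ∀ᵐ x ∂volume.restrict Ω, x ∈ convexHull ℝ (K : Set E3) → f x = g x

/-- Vector fields whose restriction to each tetrahedron lies in the local space `V`. -/
def pwV (T : Triangulation Ω) (V : Submodule ℝ VPoly) : Submodule ℝ (L2v Ω) :=
  mkSubmodule {u | ∀ K ∈ T.cells, ∃ p ∈ V, EqOnCell u (VPoly.val p) Ω K}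
    (fun K _ => ⟨0, V.zero_mem, by
      filter_upwards [Lp.coeFn_zero E3 2 (volume.restrict Ω)] with x hx _
      rw [hx]
      ext i
      simp [VPoly.val, Poly.val]⟩)
    (fun a f g hf hg K hK => by
      obtain ⟨p, hp, h1⟩ := hf K hK
      obtain ⟨q, hq, h2⟩ := hg K hK
      refine ⟨a • p + q, V.add_mem (V.smul_mem a hp) hq, ?_⟩
      filter_upwards [h1, h2, Lp.coeFn_add (a • f) g, Lp.coeFn_smul a f] with x e1 e2 e3 e4 hx
      rw [e3, Pi.add_apply, e4, Pi.smul_apply, e1 hx, e2 hx]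
      ext i
      simp [VPoly.val, Poly.val, MvPolynomial.smul_eval])

/-- Scalar fields whose restriction to each tetrahedron lies in the local space `V`. -/
def pwS (T : Triangulation Ω) (V : Submodule ℝ Poly) : Submodule ℝ (L2s Ω) :=
  mkSubmodule {f | ∀ K ∈ T.cells, ∃ p ∈ V, EqOnCell f (Poly.val p) Ω K}
    (fun K _ => ⟨0, V.zero_mem, by
      filter_upwards [Lp.coeFn_zero ℝ 2 (volume.restrict Ω)] with x hx _
      rw [hx]
      simp [Poly.val]⟩)
    (fun a f g hf hg K hK => by
      obtain ⟨p, hp, h1⟩ := hf K hK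
      obtain ⟨q, hq, h2⟩ := hg K hK
      refine ⟨a • p + q, V.add_mem (V.smul_mem a hp) hq, ?_⟩
      filter_upwards [h1, h2, Lp.coeFn_add (a • f) g, Lp.coeFn_smul a f] with x e1 e2 e3 e4 hx
      rw [e3, Pi.add_apply, e4, Pi.smul_apply, e1 hx, e2 hx]
      simp [Poly.val, MvPolynomial.smul_eval])

/-! The spaces of piecewise polynomial fields are finite-dimensional. -/

theorem ae_eq_of_cells {F : Type*} (T : Triangulation Ω) {f g : E3 → F}
    (h : ∀ K ∈ T.cells, EqOnCell f g Ω K) : f =ᵐ[volume.restrict Ω] g := by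
  have h1 : ∀ᵐ x ∂volume.restrict Ω, ∀ K : T.cells,
      x ∈ convexHull ℝ (K.1 : Set E3) → f x = g x := by
    rw [ae_all_iff]
    exact fun K => h K.1 K.2
  filter_upwards [h1, ae_restrict_mem T.isOpen.measurableSet] with x hx hxΩ
  obtain ⟨K, hK, hxK⟩ := T.exists_cell hxΩ
  exact hx ⟨K, hK⟩ hxK

instance pwV_fin (T : Triangulation Ω) (V : Submodule ℝ VPoly) [FiniteDimensional ℝ V] :
    FiniteDimensional ℝ (pwV T V) := by
  let W : Submodule ℝ (L2v Ω × (T.cells → V)) :=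
    mkSubmodule {z | ∀ K : T.cells, EqOnCell z.1 (VPoly.val (z.2 K)) Ω K}
      (fun K => by
        filter_upwards [Lp.coeFn_zero E3 2 (volume.restrict Ω)] with x hx _
        rw [Prod.fst_zero, hx]
        ext i
        simp [VPoly.val, Poly.val])
      (fun a f g hf hg K => by
        filter_upwards [hf K, hg K, Lp.coeFn_add (a • f.1) g.1, Lp.coeFn_smul a f.1]
          with x e1 e2 e3 e4 hx
        rw [Prod.fst_add, Prod.smul_fst, e3, Pi.add_apply, e4, Pi.smul_apply, e1 hx, e2 hx]
        ext i
        simp [VPoly.val, Poly.val, MvPolynomial.smul_eval])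
  have hW : FiniteDimensional ℝ W := by
    refine FiniteDimensional.of_injective ((LinearMap.snd ℝ _ _).comp W.subtype) fun z z' h => ?_
    have h2 : z.1.2 = z'.1.2 := h
    refine Subtype.ext (Prod.ext (Lp.ext (ae_eq_of_cells T fun K hK => ?_)) h2)
    have e1 := z.2 ⟨K, hK⟩
    have e2 := z'.2 ⟨K, hK⟩
    filter_upwards [e1, e2] with x a b hx
    rw [a hx, b hx, h2]
  have hle : pwV T V ≤ LinearMap.range ((LinearMap.fst ℝ _ _).comp W.subtype) := by
    intro u hu
    choose p hp he using hu
    exact ⟨⟨(u, fun K => ⟨p K.1 K.2, hp K.1 K.2⟩), fun K => he K.1 K.2⟩, rfl⟩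
  exact Submodule.finiteDimensional_of_le hle

instance pwS_fin (T : Triangulation Ω) (V : Submodule ℝ Poly) [FiniteDimensional ℝ V] :
    FiniteDimensional ℝ (pwS T V) := by
  let W : Submodule ℝ (L2s Ω × (T.cells → V)) :=
    mkSubmodule {z | ∀ K : T.cells, EqOnCell z.1 (Poly.val (z.2 K)) Ω K}
      (fun K => by
        filter_upwards [Lp.coeFn_zero ℝ 2 (volume.restrict Ω)] with x hx _
        rw [Prod.fst_zero, hx]
        simp [Poly.val])
      (fun a f g hf hg K => by
        filter_upwards [hf K, hg K, Lp.coeFn_add (a • f.1) g.1, Lp.coeFn_smul a f.1]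
          with x e1 e2 e3 e4 hx
        rw [Prod.fst_add, Prod.smul_fst, e3, Pi.add_apply, e4, Pi.smul_apply, e1 hx, e2 hx]
        simp [Poly.val, MvPolynomial.smul_eval])
  have hW : FiniteDimensional ℝ W := by
    refine FiniteDimensional.of_injective ((LinearMap.snd ℝ _ _).comp W.subtype) fun z z' h => ?_
    have h2 : z.1.2 = z'.1.2 := h
    refine Subtype.ext (Prod.ext (Lp.ext (ae_eq_of_cells T fun K hK => ?_)) h2)
    have e1 := z.2 ⟨K, hK⟩
    have e2 := z'.2 ⟨K, hK⟩
    filter_upwards [e1, e2] with x a b hx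
    rw [a hx, b hx, h2]
  have hle : pwS T V ≤ LinearMap.range ((LinearMap.fst ℝ _ _).comp W.subtype) := by
    intro u hu
    choose p hp he using hu
    exact ⟨⟨(u, fun K => ⟨p K.1 K.2, hp K.1 K.2⟩), fun K => he K.1 K.2⟩, rfl⟩
  exact Submodule.finiteDimensional_of_le hle

/-- The Lagrange (continuous Galerkin) velocity space
`{u ∈ H¹₀(Ω)³ : u|_K ∈ P_{r+1}(K)³ for all K}`. -/
def Ugrad (T : Triangulation Ω) (r : ℕ) : Submodule ℝ (L2v Ω) :=
  (⨅ i : Fin 3, (H10 Ω).comap (comp i).toLinearMap) ⊓ pwV T (PV (r + 1))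

/-- The Nédélec space `{u ∈ H₀(curl, Ω) : u|_K ∈ P_r(K)³ + x × P_r(K)³ for all K}`. -/
def Ucurl (T : Triangulation Ω) (r : ℕ) : Submodule ℝ (L2v Ω) :=
  H0curl Ω ⊓ pwV T (NEDloc r)

/-- The Raviart–Thomas space `{u ∈ H₀(div, Ω) : u|_K ∈ P_r(K)³ + x P_r(K) for all K}`. -/
def Udiv (T : Triangulation Ω) (r : ℕ) : Submodule ℝ (L2v Ω) :=
  H0div Ω ⊓ pwV T (RTloc r)

/-- The discontinuous Galerkin space `{f ∈ L²(Ω) : f|_K ∈ P_s(K) for all K}`. -/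
def Fh (T : Triangulation Ω) (s : ℕ) : Submodule ℝ (L2s Ω) := pwS T (P s)

instance (T : Triangulation Ω) (r : ℕ) : FiniteDimensional ℝ (Ugrad T r) :=
  Submodule.finiteDimensional_of_le (inf_le_right : _ ≤ pwV T (PV (r + 1)))

instance (T : Triangulation Ω) (r : ℕ) : FiniteDimensional ℝ (Ucurl T r) :=
  Submodule.finiteDimensional_of_le (inf_le_right : _ ≤ pwV T (NEDloc r))

instance (T : Triangulation Ω) (r : ℕ) : FiniteDimensional ℝ (Udiv T r) :=
  Submodule.finiteDimensional_of_le (inf_le_right : _ ≤ pwV T (RTloc r))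

instance (T : Triangulation Ω) (s : ℕ) : FiniteDimensional ℝ (Fh T s) :=
  inferInstanceAs (FiniteDimensional ℝ (pwS T (P s)))

/-! ### The discrete operators and forms -/

/-- The `L²`-orthogonal projector onto the Raviart–Thomas space. -/
def piDiv (T : Triangulation Ω) (r : ℕ) : L2v Ω →L[ℝ] Udiv T r :=
  (Udiv T r).orthogonalProjectionOnto

/-- The curl on the Nédélec space, as a linear map. -/
def curlU (T : Triangulation Ω) (r : ℕ) : Ucurl T r →ₗ[ℝ] L2v Ω where
  toFun u := curl (u : L2v Ω)
  map_add' u v := by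
    have h := (hasCurl0_curl u.2.1).lin 1 (hasCurl0_curl v.2.1)
    rw [one_smul, one_smul] at h
    exact (hasCurl0_curl (u + v).2.1).unique T.isOpen h
  map_smul' a u := by
    have h := (hasCurl0_curl u.2.1).lin a HasCurl0.zero
    rw [add_zero, add_zero] at h
    exact (hasCurl0_curl (a • u).2.1).unique T.isOpen h

/-- The weak curl `curl_h`, determined by `⟨curl_h u, v⟩ = ⟨u, curl v⟩` for all `v ∈ U_h^curl`. -/
def curlh (T : Triangulation Ω) (r : ℕ) (u : L2v Ω) : Ucurl T r :=
  ContinuousLinearMap.adjoint (LinearMap.toContinuousLinearMap (curlU T r)) u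

theorem inner_curlh (T : Triangulation Ω) (r : ℕ) (u : L2v Ω) (v : Ucurl T r) :
    inner ℝ (curlh T r u : L2v Ω) (v : L2v Ω) = inner ℝ u (curl (v : L2v Ω)) :=
  ContinuousLinearMap.adjoint_inner_left (LinearMap.toContinuousLinearMap (curlU T r)) v u

/-- `e_h(B, C) = -ν ⟨curl_h B, curl_h C⟩`. -/
def eh (T : Triangulation Ω) (r : ℕ) (ν : ℝ) (B C : Udiv T r) : ℝ :=
  - ν * inner ℝ (curlh T r B : L2v Ω) (curlh T r C : L2v Ω)

/-- The divergence `∂₁u₁ + ∂₂u₂ + ∂₃u₃` of a field `u ∈ H¹₀(Ω)³`. -/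
def divGrad (u : L2v Ω) : L2s Ω := ∑ i, comp i (grad (comp i u))

/-- `d(u, v) = - ∫_Ω [μ ∇u : ∇v + (λ + μ) div u div v]`. -/
def dform (mu lam : ℝ) (u v : L2v Ω) : ℝ :=
  - (mu * (∑ i, inner ℝ (grad (comp i u)) (grad (comp i v)))
      + (lam + mu) * inner ℝ (divGrad u) (divGrad v))

/-- `a(w, u, v) = - ∫_Ω w · [u, v]`, with the Lie bracket `[u, v] = u · ∇v - v · ∇u`. -/
def aform (w u v : L2v Ω) : ℝ :=
  - ∫ x in Ω, (∑ i, w x i *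
      (∑ j, (u x j * grad (comp i v) x j - v x j * grad (comp i u) x j)))

open Classical in
/-- The polynomial `f|_K` of a field `f` that is polynomial on `K` (it is unique, because the
tetrahedron `K` is not degenerate). -/
def restr (f : L2s Ω) (K : Finset E3) : Poly :=
  if h : ∃ p : Poly, EqOnCell f (Poly.val p) Ω K then h.choose else 0

/-- The vector field `u|_K`, for a field `u` that is polynomial on `K`. -/
def restrV (u : L2v Ω) (K : Finset E3) : VPoly := fun i => restr (comp i u) K

open Classical in
/-- The unit normal to the common face of the tetrahedra `K` and `L` that points from `K` to `L`:
the normalized component, orthogonal to the face, of the vector joining the barycentres. -/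
def normal (K L : Finset E3) : E3 :=
  let d : E3 := (vectorSpan ℝ ((K ∩ L : Finset E3) : Set E3))ᗮ.starProjection
    (L.centroid ℝ id - K.centroid ℝ id)
  ‖d‖⁻¹ • d

/-- The jump `f₁ n₁ + f₂ n₂` of `f` across the common face of `K` and `L`. -/
def jump (f : L2s Ω) (K L : Finset E3) (x : E3) : E3 :=
  (restr f K).val x • normal K L + (restr f L).val x • normal L K

/-- The average `(f₁ + f₂)/2` on the common face of `K` and `L`. -/
def avg (f : L2s Ω) (K L : Finset E3) (x : E3) : ℝ :=
  ((restr f K).val x + (restr f L).val x) / 2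

/-- The value of a piecewise polynomial vector field on the common face of `K` and `L`. Only its
normal component is used below, and that of a field in `H₀(div, Ω)` is the same from both sides. -/
def avgV (u : L2v Ω) (K L : Finset E3) (x : E3) : E3 :=
  (2⁻¹ : ℝ) • ((restrV u K).val x + (restrV u L).val x)

open Classical in
/-- The ordered pairs `(K₁, K₂)` of tetrahedra with a common triangular face. Each interior face is
obtained from exactly two of them. -/
def facePairs (T : Triangulation Ω) : Finset (Finset E3 × Finset E3) :=
  (T.cells ×ˢ T.cells).filter fun q => (q.1 ∩ q.2).card = 3

open Classical in
/-- `b_h(f, g, u) = - ∑_K ∫_K (u · ∇f) g dx + ∑_e ∫_e u · ⟦f⟧ {g} ds`, where `e` runs through the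
interior faces; the factor `1/2` accounts for the two orderings of the tetrahedra at a face. -/
def bh (T : Triangulation Ω) (f g : L2s Ω) (u : L2v Ω) : ℝ :=
  - (∑ K ∈ T.cells, ∫ x in convexHull ℝ (K : Set E3),
      (∑ i, u x i * Poly.val (MvPolynomial.pderiv i (restr f K)) x) * g x)
  + (1 / 2) * (∑ q ∈ facePairs T,
      ∫ x in convexHull ℝ ((q.1 ∩ q.2 : Finset E3) : Set E3),
        inner ℝ (avgV u q.1 q.2 x) (jump f q.1 q.2 x) * avg g q.1 q.2 x ∂μHE[2])

/-- `⟨u × v, w⟩ = ∫_Ω (u × v) · w`. -/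
def crossInner (u v w : L2v Ω) : ℝ := ∫ x in Ω, inner ℝ (cross (u x) (v x)) (w x)

/-! ### The Lagrangian and the semidiscrete scheme -/

/-- Triples `(u, ρ, B)` of discrete velocity, density and magnetic field. -/
abbrev State (T : Triangulation Ω) (r s : ℕ) : Type := Ugrad T r × Fh T s × Udiv T r

/-- The functional `ℓ` is differentiable at the state `x`, with `δℓ/δu = p`, `δℓ/δρ = q` and
`δℓ/δB = m`: the first variation is
`δℓ = ⟨p, δu⟩ + ⟨q, δρ⟩ + ⟨m, δB⟩` for all `δu ∈ U_h^grad`, `δρ ∈ F_h`, `δB ∈ U_h^div`. -/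
def HasVarDeriv {T : Triangulation Ω} {r s : ℕ} (l : State T r s → ℝ) (x : State T r s)
    (p : L2v Ω) (q : L2s Ω) (m : L2v Ω) : Prop :=
  ∃ D : State T r s →L[ℝ] ℝ, HasFDerivAt l D x ∧
    ∀ (v : Ugrad T r) (σ : Fh T s) (C : Udiv T r),
      D (v, σ, C) = inner ℝ p (v : L2v Ω) + inner ℝ q (σ : L2s Ω) + inner ℝ m (C : L2v Ω)

/-- The functions `u, w : [0, τ] → U_h^grad`, `ρ, θ : [0, τ] → F_h`, `B : [0, τ] → U_h^div` and
`J, H, U, E, α, j : [0, τ] → U_h^curl` solve the semidiscrete scheme on the time interval `[0, τ]`.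
Here `lu, lr, lB` are `δℓ/δu, δℓ/δρ, δℓ/δB` as functions of the state, and `⟨∂ₜ(δℓ/δu), v⟩` for
fixed `v` is the time derivative of `⟨δℓ/δu, v⟩`. -/
structure IsSolution (T : Triangulation Ω) (r s : ℕ) (mu lam ν τ : ℝ)
    (lu : State T r s → L2v Ω) (lr : State T r s → L2s Ω) (lB : State T r s → L2v Ω)
    (u w : ℝ → Ugrad T r) (ρ θ : ℝ → Fh T s) (B : ℝ → Udiv T r)
    (J H U E α j : ℝ → Ucurl T r) : Prop where
  diff_u : DifferentiableOn ℝ u (Icc 0 τ)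
  diff_ρ : DifferentiableOn ℝ ρ (Icc 0 τ)
  diff_B : DifferentiableOn ℝ B (Icc 0 τ)
  diff_lu : ∀ v : Ugrad T r,
    DifferentiableOn ℝ (fun t => inner ℝ (lu (u t, ρ t, B t)) (v : L2v Ω)) (Icc 0 τ)
  velocity : ∀ t ∈ Icc 0 τ, ∀ v : Ugrad T r,
    derivWithin (fun t' => inner ℝ (lu (u t', ρ t', B t')) (v : L2v Ω)) (Icc 0 τ) t
      + aform (w t : L2v Ω) (u t : L2v Ω) (v : L2v Ω)
      + bh T (θ t : L2s Ω) (ρ t : L2s Ω) (v : L2v Ω)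
      + inner ℝ (α t : L2v Ω) (v : L2v Ω)
    = dform mu lam (u t : L2v Ω) (v : L2v Ω)
  density : ∀ t ∈ Icc 0 τ, ∀ σ : Fh T s,
    inner ℝ ((derivWithin ρ (Icc 0 τ) t : Fh T s) : L2s Ω) (σ : L2s Ω)
      + bh T (σ : L2s Ω) (ρ t : L2s Ω) (u t : L2v Ω) = 0
  magnetic : ∀ t ∈ Icc 0 τ, ∀ C : Udiv T r,
    inner ℝ ((derivWithin B (Icc 0 τ) t : Udiv T r) : L2v Ω) (C : L2v Ω)
      + inner ℝ (curl (E t : L2v Ω)) (C : L2v Ω)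
    = - ν * inner ℝ (curl (j t : L2v Ω)) (C : L2v Ω)
  def_w : ∀ t ∈ Icc 0 τ, ∀ z : Ugrad T r,
    inner ℝ (w t : L2v Ω) (z : L2v Ω) = inner ℝ (lu (u t, ρ t, B t)) (z : L2v Ω)
  def_θ : ∀ t ∈ Icc 0 τ, ∀ σ : Fh T s,
    inner ℝ (θ t : L2s Ω) (σ : L2s Ω) = inner ℝ (lr (u t, ρ t, B t)) (σ : L2s Ω)
  def_J : ∀ t ∈ Icc 0 τ, ∀ K : Ucurl T r,
    inner ℝ (J t : L2v Ω) (K : L2v Ω) = - inner ℝ (lB (u t, ρ t, B t)) (curl (K : L2v Ω))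
  def_H : ∀ t ∈ Icc 0 τ, ∀ G : Ucurl T r,
    inner ℝ (H t : L2v Ω) (G : L2v Ω) = inner ℝ (B t : L2v Ω) (G : L2v Ω)
  def_U : ∀ t ∈ Icc 0 τ, ∀ V : Ucurl T r,
    inner ℝ (U t : L2v Ω) (V : L2v Ω) = inner ℝ (u t : L2v Ω) (V : L2v Ω)
  def_E : ∀ t ∈ Icc 0 τ, ∀ F : Ucurl T r,
    inner ℝ (E t : L2v Ω) (F : L2v Ω) = - crossInner (U t : L2v Ω) (H t : L2v Ω) (F : L2v Ω)
  def_α : ∀ t ∈ Icc 0 τ, ∀ β : Ucurl T r,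
    inner ℝ (α t : L2v Ω) (β : L2v Ω) = - crossInner (J t : L2v Ω) (H t : L2v Ω) (β : L2v Ω)
  def_j : ∀ t ∈ Icc 0 τ, ∀ k : Ucurl T r,
    inner ℝ (j t : L2v Ω) (k : L2v Ω) = inner ℝ (B t : L2v Ω) (curl (k : L2v Ω))

end MHD

end

open MeasureTheory Set
open scoped ContDiff

noncomputable section

namespace MHD

/-! ### Classical identities for test fields -/

/-! The whole argument rests on one structural fact: the curl maps the Nédélec space into the
Raviart–Thomas space (`curl_mem_Udiv`). Globally, a curl of a field in `H₀(curl)` is divergence-free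
with zero normal trace, by duality from `curl grad = 0` and `div curl = 0` for test fields. Locally,
the formal curl of a polynomial in `NEDloc r` lies in `RTloc r`, and it agrees with the weak curl
inside each tetrahedron. Hence the tested induction equation is an identity of fields, `∂ₜB = curl
F` with `F = -(E + ν j)` (`IsSolution.derivWithin_B`).

Divergence: pairing `∂ₜB = curl F` with the gradient of a test function gives zero, so the weak
divergence of `B` does not change. Mass: the constant `1` is an admissible density test function,
and `b_h(1, ·, ·) = 0` because its gradient and its jumps vanish.

Energy: after the chain rule the terms `⟨δℓ/δu, ∂ₜu⟩` cancel. The momentum equation is tested with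
`u`, where `a(w, u, u) = 0`, and the continuity equation with `θ`, so the two `b_h` terms cancel.
The definition of `J` tested with `F` turns `⟨δℓ/δB, ∂ₜB⟩` into `⟨J, E⟩ + ν⟨J, j⟩`. Since `α` is a
Nédélec field, `⟨α, u⟩ = ⟨α, U⟩`, and antisymmetry of the triple product gives `⟨α, U⟩ + ⟨E, J⟩ =
0`. What remains besides viscosity is the resistive term, because `curl_h B = j` and `curl_h π_h^div
(δℓ/δB) = -J`.

Helicity: the curl is symmetric on fields with vanishing tangential trace (`HasCurl0.inner_comm`),
so `⟨A, B⟩` is independent of the potential. Thus `A`, which need not be regular in time, may be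
replaced by a potential depending linearly on `B`, and the derivative becomes `2⟨F, B⟩`. Finally
`⟨E, B⟩ = ⟨E, H⟩ = -⟨U × H, H⟩ = 0`, leaving `-2ν⟨j, B⟩`. -/

theorem IsTest.coord {Ω : Set E3} {φ : E3 → E3} (h : IsTest Ω φ) (i : Fin 3) :
    IsTest Ω (fun x => φ x i) := by
  have hp : ContDiff ℝ ∞ (EuclideanSpace.proj i : E3 →L[ℝ] ℝ) := ContinuousLinearMap.contDiff _
  have hs : tsupport (fun x => φ x i) ⊆ tsupport φ :=
    closure_mono fun x hx hx' => hx (by simp [hx'])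
  exact ⟨hp.comp h.smooth, h.compact.of_isClosed_subset (isClosed_tsupport _) hs, hs.trans h.supp⟩

theorem IsTest.of_coord {Ω : Set E3} {φ : E3 → E3} (h : ∀ i, IsTest Ω (fun x => φ x i)) :
    IsTest Ω φ := by
  have hs : tsupport φ ⊆ ⋃ i, tsupport (fun x => φ x i) := by
    refine closure_minimal (fun x hx => ?_) (isClosed_iUnion_of_finite fun i => isClosed_tsupport _)
    by_contra hn
    refine hx ?_
    ext i
    exact image_eq_zero_of_notMem_tsupport (f := fun y => φ y i)
      fun hi => hn (mem_iUnion.2 ⟨i, hi⟩)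
  refine ⟨(contDiff_piLp 2).2 fun i => (h i).smooth, ?_, ?_⟩
  · exact (isCompact_iUnion fun i => (h i).compact).of_isClosed_subset (isClosed_tsupport _) hs
  · exact hs.trans (iUnion_subset fun i => (h i).supp)

theorem IsTest.add {Ω : Set E3} {φ ψ : E3 → ℝ} (h : IsTest Ω φ) (h' : IsTest Ω ψ) :
    IsTest Ω (fun x => φ x + ψ x) :=
  ⟨h.smooth.add h'.smooth, h.compact.add h'.compact,
    (tsupport_add φ ψ).trans (union_subset h.supp h'.supp)⟩

theorem IsTest.neg {Ω : Set E3} {φ : E3 → ℝ} (h : IsTest Ω φ) : IsTest Ω (fun x => - φ x) := by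
  have hs : tsupport (fun x => - φ x) = tsupport φ := by simp [tsupport, Function.support_fun_neg]
  exact ⟨h.smooth.neg, by simpa [HasCompactSupport, hs] using h.compact, hs ▸ h.supp⟩

theorem IsTest.sub {Ω : Set E3} {φ ψ : E3 → ℝ} (h : IsTest Ω φ) (h' : IsTest Ω ψ) :
    IsTest Ω (fun x => φ x - ψ x) := by
  simpa only [sub_eq_add_neg] using h.add h'.neg

theorem IsTest.fderiv_apply {Ω : Set E3} {φ : E3 → ℝ} (h : IsTest Ω φ) (v : E3) :
    IsTest Ω (fun x => fderiv ℝ φ x v) := by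
  refine ⟨(h.smooth.fderiv_right (m := ∞) (by simp)).clm_apply contDiff_const, ?_, ?_⟩
  · exact HasCompactSupport.fderiv_apply ℝ h.compact v
  · exact (tsupport_fderiv_apply_subset ℝ v).trans h.supp

theorem pd_eq_fderiv_coord {Ω : Set E3} {φ : E3 → E3} (h : IsTest Ω φ) (i j : Fin 3) (x : E3) :
    pd φ i j x = fderiv ℝ (fun y => φ y i) x (EuclideanSpace.single j 1) := by
  have hd : DifferentiableAt ℝ φ x := h.smooth.contDiffAt.differentiableAt (by simp)
  have := ((EuclideanSpace.proj i : E3 →L[ℝ] ℝ).hasFDerivAt.comp x hd.hasFDerivAt).fderiv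
  have h2 : fderiv ℝ (fun y => φ y i) x = _ := this
  rw [h2]
  rfl

theorem gradient_coord (φ : E3 → ℝ) (i : Fin 3) (x : E3) :
    gradient φ x i = fderiv ℝ φ x (EuclideanSpace.single i 1) := by
  have h : inner ℝ (gradient φ x) (EuclideanSpace.single i (1 : ℝ) : E3)
      = fderiv ℝ φ x (EuclideanSpace.single i 1) := by
    rw [gradient, InnerProductSpace.toDual_symm_apply]
  rw [← h, EuclideanSpace.inner_single_right]
  simp

theorem IsTest.gradient {Ω : Set E3} {φ : E3 → ℝ} (h : IsTest Ω φ) : IsTest Ω (gradient φ) :=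
  IsTest.of_coord fun i => by
    simp only [gradient_coord]
    exact h.fderiv_apply _

theorem IsTest.pd {Ω : Set E3} {φ : E3 → E3} (h : IsTest Ω φ) (i j : Fin 3) :
    IsTest Ω (pd φ i j) := by
  have : MHD.pd φ i j = fun x => fderiv ℝ (fun y => φ y i) x (EuclideanSpace.single j 1) :=
    funext fun x => pd_eq_fderiv_coord h i j x
  rw [this]
  exact (h.coord i).fderiv_apply _

theorem IsTest.ccurl {Ω : Set E3} {φ : E3 → E3} (h : IsTest Ω φ) : IsTest Ω (ccurl φ) :=
  IsTest.of_coord fun i => by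
    fin_cases i
    · exact (h.pd 2 1).sub (h.pd 1 2)
    · exact (h.pd 0 2).sub (h.pd 2 0)
    · exact (h.pd 1 0).sub (h.pd 0 1)

theorem fderiv_fderiv_comm {f : E3 → ℝ} (hf : ContDiff ℝ ∞ f) (x a b : E3) :
    fderiv ℝ (fun y => fderiv ℝ f y a) x b = fderiv ℝ (fun y => fderiv ℝ f y b) x a := by
  have hd : DifferentiableAt ℝ (fderiv ℝ f) x :=
    (hf.fderiv_right (m := ∞) (by simp)).contDiffAt.differentiableAt (by simp)
  have h1 : ∀ v w, fderiv ℝ (fun y => fderiv ℝ f y v) x w = fderiv ℝ (fderiv ℝ f) x w v := by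
    intro v w
    rw [fderiv_clm_apply hd (differentiableAt_const v)]
    simp
  rw [h1, h1]
  exact (hf.contDiffAt.isSymmSndFDerivAt (by simpa using ENat.LEInfty.out)).eq b a

theorem ccurl_gradient {Ω : Set E3} {φ : E3 → ℝ} (h : IsTest Ω φ) (x : E3) :
    ccurl (gradient φ) x = 0 := by
  ext i
  -- Schwarz's rule is supplied only in oriented instances, fixing one order for each mixed
  -- derivative.
  fin_cases i <;>
    simp [ccurl, pd_eq_fderiv_coord h.gradient, gradient_coord, fderiv_fderiv_comm h.smooth x _
      (EuclideanSpace.single (0 : Fin 3) 1), fderiv_fderiv_comm h.smooth x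
      (EuclideanSpace.single (2 : Fin 3) 1) (EuclideanSpace.single (1 : Fin 3) 1)]

theorem cdiv_ccurl {Ω : Set E3} {φ : E3 → E3} (h : IsTest Ω φ) (x : E3) :
    cdiv (ccurl φ) x = 0 := by
  have hd : ∀ i (v : E3), DifferentiableAt ℝ (fun y => fderiv ℝ (fun z => φ z i) y v) x :=
    fun i v => ((h.coord i).fderiv_apply v).smooth.contDiffAt.differentiableAt (by simp)
  have e0 : (fun y => ccurl φ y 0) = fun y => fderiv ℝ (fun z => φ z 2) y
      (EuclideanSpace.single 1 1) - fderiv ℝ (fun z => φ z 1) y (EuclideanSpace.single 2 1) :=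
    funext fun y => by simp [ccurl, pd_eq_fderiv_coord h]
  have e1 : (fun y => ccurl φ y 1) = fun y => fderiv ℝ (fun z => φ z 0) y
      (EuclideanSpace.single 2 1) - fderiv ℝ (fun z => φ z 2) y (EuclideanSpace.single 0 1) :=
    funext fun y => by simp [ccurl, pd_eq_fderiv_coord h]
  have e2 : (fun y => ccurl φ y 2) = fun y => fderiv ℝ (fun z => φ z 1) y
      (EuclideanSpace.single 0 1) - fderiv ℝ (fun z => φ z 0) y (EuclideanSpace.single 1 1) :=
    funext fun y => by simp [ccurl, pd_eq_fderiv_coord h]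
  simp only [cdiv, Fin.sum_univ_three, pd_eq_fderiv_coord h.ccurl]
  rw [e0, e1, e2, fderiv_fun_sub (hd _ _) (hd _ _), fderiv_fun_sub (hd _ _) (hd _ _),
    fderiv_fun_sub (hd _ _) (hd _ _)]
  simp only [sub_apply]
  rw [fderiv_fderiv_comm (h.coord 2).smooth x _ (EuclideanSpace.single (0 : Fin 3) 1),
    fderiv_fderiv_comm (h.coord 1).smooth x _ (EuclideanSpace.single (0 : Fin 3) 1),
    fderiv_fderiv_comm (h.coord 0).smooth x _ (EuclideanSpace.single (1 : Fin 3) 1)]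
  ring

/-! ### Curls are divergence-free with vanishing normal trace -/

theorem integral_zero_inner {Ω : Set E3} (φ : E3 → E3) :
    ∫ x in Ω, inner ℝ ((0 : L2v Ω) x) (φ x) = 0 := by
  rw [← integral_zero E3 ℝ (μ := volume.restrict Ω)]
  refine integral_congr_ae ?_
  filter_upwards [Lp.coeFn_zero E3 2 (volume.restrict Ω)] with x hx
  rw [hx]
  simp

theorem integral_zero_mul {Ω : Set E3} (φ : E3 → ℝ) :
    ∫ x in Ω, (0 : L2s Ω) x * φ x = 0 := by
  rw [← integral_zero E3 ℝ (μ := volume.restrict Ω)]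
  refine integral_congr_ae ?_
  filter_upwards [Lp.coeFn_zero ℝ 2 (volume.restrict Ω)] with x hx
  rw [hx]
  simp

/-- The curl of a test field is again a test field, so it may be inserted into the definition of the
weak gradient; its divergence vanishes. -/
theorem HasWeakGrad.hasWeakCurl {Ω : Set E3} {f : L2s Ω} {G : L2v Ω} (h : HasWeakGrad f G) :
    HasWeakCurl G 0 := fun φ hφ => by
  rw [integral_zero_inner, h _ hφ.ccurl]
  simp [cdiv_ccurl hφ]

theorem HasWeakCurl.hasWeakDiv {Ω : Set E3} {u w : L2v Ω} (h : HasWeakCurl u w) :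
    HasWeakDiv w 0 := fun φ hφ => by
  rw [integral_zero_mul, h _ hφ.gradient]
  simp [ccurl_gradient hφ]

/-- The normal trace vanishes because an `H¹` gradient is an admissible curl-free field in Green's
formula for `u`. -/
theorem HasCurl0.hasDiv0 {Ω : Set E3} {u w : L2v Ω} (h : HasCurl0 u w) : HasDiv0 w 0 :=
  ⟨h.1.hasWeakDiv, fun f G hG => by rw [h.2 G 0 hG.hasWeakCurl]; simp⟩

/-! ### Polynomials -/

/-- Links formal partial derivatives to calculus, so that integration by parts against polynomials
yields `pderiv`. -/
theorem Poly.hasFDerivAt (p : Poly) (x : E3) :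
    HasFDerivAt p.val (∑ i, Poly.val (MvPolynomial.pderiv i p) x •
      (EuclideanSpace.proj i : E3 →L[ℝ] ℝ)) x := by
  induction p using MvPolynomial.induction_on with
  | C a =>
    have : Poly.val (MvPolynomial.C a) = fun _ => a := funext fun y => by simp [Poly.val]
    rw [this]
    simpa [Poly.val] using hasFDerivAt_const a x
  | add p q hp hq =>
    have : Poly.val (p + q) = fun y => Poly.val p y + Poly.val q y :=
      funext fun y => by simp [Poly.val]
    rw [this]
    refine (hp.add hq).congr_fderiv ?_
    rw [← Finset.sum_add_distrib]
    exact Finset.sum_congr rfl fun i _ => by simp [Poly.val, add_smul]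
  | mul_X p j hp =>
    have : Poly.val (p * MvPolynomial.X j) =
        fun y => Poly.val p y * (EuclideanSpace.proj j : E3 →L[ℝ] ℝ) y :=
      funext fun y => by simp [Poly.val]
    rw [this]
    refine (hp.mul (EuclideanSpace.proj j : E3 →L[ℝ] ℝ).hasFDerivAt).congr_fderiv ?_
    ext v
    simp only [Fin.sum_univ_three, Poly.val]
    fin_cases j <;> simp [MvPolynomial.pderiv_X] <;> ring

theorem Poly.fderiv_single (p : Poly) (x : E3) (j : Fin 3) :
    fderiv ℝ p.val x (EuclideanSpace.single j 1) = Poly.val (MvPolynomial.pderiv j p) x := by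
  rw [(p.hasFDerivAt x).fderiv]
  simp

theorem Poly.continuous (p : Poly) : Continuous p.val :=
  continuous_iff_continuousAt.2 fun x => (p.hasFDerivAt x).continuousAt

theorem VPoly.continuous (p : VPoly) : Continuous p.val :=
  (PiLp.continuous_toLp 2 _).comp (continuous_pi fun i => (p i).continuous)

/-- The curl of a polynomial vector field. -/
def polyCurl : VPoly →ₗ[ℝ] VPoly where
  toFun p := ![MvPolynomial.pderiv 1 (p 2) - MvPolynomial.pderiv 2 (p 1),
    MvPolynomial.pderiv 2 (p 0) - MvPolynomial.pderiv 0 (p 2),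
    MvPolynomial.pderiv 0 (p 1) - MvPolynomial.pderiv 1 (p 0)]
  map_add' p q := by
    funext i
    fin_cases i <;> simp <;> ring
  map_smul' a q := by
    funext i
    fin_cases i <;> simp [smul_sub]

/-- Every monomial is an eigenvector of `X_j ∂_j`, so the degree does not grow. -/
theorem X_mul_pderiv_mem {r : ℕ} {p : Poly} (hp : p ∈ P r) (j : Fin 3) :
    MvPolynomial.X j * MvPolynomial.pderiv j p ∈ P r := by
  conv_rhs => rw [p.as_sum]
  rw [map_sum, Finset.mul_sum]
  refine Submodule.sum_mem _ fun m hm => ?_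
  rw [MvPolynomial.X_mul_pderiv_monomial]
  refine Submodule.smul_of_tower_mem _ _ ?_
  rw [P, MvPolynomial.mem_restrictTotalDegree] at hp ⊢
  exact (MvPolynomial.totalDegree_monomial_le _ _).trans ((MvPolynomial.le_totalDegree hm).trans hp)

theorem pderiv_mem {r : ℕ} {p : Poly} (hp : p ∈ P r) (j : Fin 3) :
    MvPolynomial.pderiv j p ∈ P r := by
  conv_rhs => rw [p.as_sum]
  rw [map_sum]
  refine Submodule.sum_mem _ fun m hm => ?_
  rw [MvPolynomial.pderiv_monomial, P, MvPolynomial.mem_restrictTotalDegree]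
  rw [P, MvPolynomial.mem_restrictTotalDegree] at hp
  refine (MvPolynomial.totalDegree_monomial_le _ _).trans (le_trans ?_
    ((MvPolynomial.le_totalDegree hm).trans hp))
  rw [Finsupp.sum_fintype _ _ (by simp), Finsupp.sum_fintype _ _ (by simp)]
  exact Finset.sum_le_sum fun i _ => by simp

theorem polyCurl_mem_PV {r : ℕ} {p : VPoly} (hp : p ∈ PV r) : polyCurl p ∈ PV r := by
  have h : ∀ i j, MvPolynomial.pderiv j (p i) ∈ P r := fun i j => pderiv_mem (hp i (mem_univ i)) j
  intro i _
  fin_cases i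
  · exact (P r).sub_mem (h 2 1) (h 1 2)
  · exact (P r).sub_mem (h 0 2) (h 2 0)
  · exact (P r).sub_mem (h 1 0) (h 0 1)

/-- `curl (x × q) = x div q - (x · ∇) q - 2 q`. -/
theorem polyCurl_crossX (q : VPoly) :
    polyCurl (crossX q) = mulX (∑ j, MvPolynomial.pderiv j (q j))
      - (fun i => ∑ j, MvPolynomial.X j * MvPolynomial.pderiv j (q i)) - (2 : ℝ) • q := by
  funext i
  fin_cases i <;>
    simp [polyCurl, crossX, mulX, Fin.sum_univ_three, MvPolynomial.pderiv_X, two_smul] <;> ring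

/-- In the formula for `curl (x × q)` only `x div q` can leave `P_r³`, and it lies in the enrichment
`x P_r`. -/
theorem polyCurl_mem_RTloc {r : ℕ} {p : VPoly} (hp : p ∈ NEDloc r) : polyCurl p ∈ RTloc r := by
  obtain ⟨a, ha, b, ⟨q, hq, rfl⟩, rfl⟩ := Submodule.mem_sup.1 hp
  have hq' : ∀ i, q i ∈ P r := fun i => hq i (mem_univ i)
  rw [map_add, polyCurl_crossX]
  refine (RTloc r).add_mem (Submodule.mem_sup_left (polyCurl_mem_PV ha)) ?_
  refine (RTloc r).sub_mem ((RTloc r).sub_mem ?_ ?_) ?_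
  · exact Submodule.mem_sup_right
      ⟨_, (P r).sum_mem fun j _ => pderiv_mem (hq' j) j, rfl⟩
  · exact Submodule.mem_sup_left fun i _ => (P r).sum_mem fun j _ => X_mul_pderiv_mem (hq' i) j
  · exact Submodule.mem_sup_left ((PV r).smul_mem _ hq)

/-! ### The curl maps the Nédélec space into the Raviart–Thomas space -/

theorem integral_poly_mul_fderiv {Ω : Set E3} (p : Poly) {φ : E3 → ℝ} (hφ : IsTest Ω φ)
    (j : Fin 3) :
    ∫ x, p.val x * fderiv ℝ φ x (EuclideanSpace.single j 1)
      = - ∫ x, Poly.val (MvPolynomial.pderiv j p) x * φ x := by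
  have hd := hφ.fderiv_apply (EuclideanSpace.single j (1 : ℝ))
  simp only [← Poly.fderiv_single]
  refine integral_mul_fderiv_eq_neg_fderiv_mul_of_integrable ?_ ?_ ?_
    (fun x _ => (p.hasFDerivAt x).differentiableAt)
    fun x _ => hφ.smooth.contDiffAt.differentiableAt (by simp)
  · simp only [Poly.fderiv_single]
    exact ((Poly.continuous _).mul hφ.smooth.continuous).integrable_of_hasCompactSupport
      hφ.compact.mul_left
  · exact (p.continuous.mul hd.smooth.continuous).integrable_of_hasCompactSupport
      hd.compact.mul_left
  · exact (p.continuous.mul hφ.smooth.continuous).integrable_of_hasCompactSupport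
      hφ.compact.mul_left

theorem integrable_poly_mul {Ω : Set E3} (p : Poly) {φ : E3 → ℝ} (hφ : IsTest Ω φ) :
    Integrable (fun x => p.val x * φ x) :=
  (p.continuous.mul hφ.smooth.continuous).integrable_of_hasCompactSupport hφ.compact.mul_left

theorem integral_poly_mul_pd {Ω : Set E3} (p : Poly) {φ : E3 → E3} (hφ : IsTest Ω φ)
    (i j : Fin 3) :
    ∫ x, p.val x * pd φ i j x = - ∫ x, Poly.val (MvPolynomial.pderiv j p) x * φ x i := by
  simp only [pd_eq_fderiv_coord hφ]
  exact integral_poly_mul_fderiv p (hφ.coord i) j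

theorem integral_three_sub {μ : Measure E3} {a b c d e f : E3 → ℝ} (ha : Integrable a μ)
    (hb : Integrable b μ) (hc : Integrable c μ) (hd : Integrable d μ) (he : Integrable e μ)
    (hf : Integrable f μ) :
    ∫ x, ((a x - b x) + (c x - d x) + (e x - f x)) ∂μ =
      (∫ x, a x ∂μ - ∫ x, b x ∂μ) + (∫ x, c x ∂μ - ∫ x, d x ∂μ)
        + (∫ x, e x ∂μ - ∫ x, f x ∂μ) := by
  have h1 : Integrable (fun x => a x - b x) μ := ha.sub hb
  have h2 : Integrable (fun x => c x - d x) μ := hc.sub hd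
  have h3 : Integrable (fun x => e x - f x) μ := he.sub hf
  have h4 : Integrable (fun x => (a x - b x) + (c x - d x)) μ := h1.add h2
  rw [integral_add h4 h3, integral_add h1 h2, integral_sub ha hb, integral_sub hc hd,
    integral_sub he hf]

/-- Integration by parts over all of space: the compact support of `φ` removes boundary terms and
makes every integrand integrable. -/
theorem integral_poly_inner_ccurl {Ω : Set E3} (p : VPoly) {φ : E3 → E3} (hφ : IsTest Ω φ) :
    ∫ x, inner ℝ (p.val x) (ccurl φ x) = ∫ x, inner ℝ ((polyCurl p).val x) (φ x) := by
  have hI : ∀ (q : Poly) i j, Integrable (fun x => q.val x * pd φ i j x) :=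
    fun q i j => integrable_poly_mul q (hφ.pd i j)
  have hJ : ∀ (q : Poly) i, Integrable (fun x => q.val x * φ x i) :=
    fun q i => integrable_poly_mul q (hφ.coord i)
  have h1 : ∀ x, inner ℝ (p.val x) (ccurl φ x) =
      ((p 0).val x * pd φ 2 1 x - (p 0).val x * pd φ 1 2 x)
      + ((p 1).val x * pd φ 0 2 x - (p 1).val x * pd φ 2 0 x)
      + ((p 2).val x * pd φ 1 0 x - (p 2).val x * pd φ 0 1 x) := fun x => by
    simp [PiLp.inner_apply, Fin.sum_univ_three, VPoly.val, ccurl]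
    ring
  have h2 : ∀ x, inner ℝ ((polyCurl p).val x) (φ x) =
      (Poly.val (MvPolynomial.pderiv 1 (p 2)) x * φ x 0
        - Poly.val (MvPolynomial.pderiv 2 (p 1)) x * φ x 0)
      + (Poly.val (MvPolynomial.pderiv 2 (p 0)) x * φ x 1
        - Poly.val (MvPolynomial.pderiv 0 (p 2)) x * φ x 1)
      + (Poly.val (MvPolynomial.pderiv 0 (p 1)) x * φ x 2
        - Poly.val (MvPolynomial.pderiv 1 (p 0)) x * φ x 2) := fun x => by
    simp [PiLp.inner_apply, Fin.sum_univ_three, VPoly.val, polyCurl, Poly.val]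
    ring
  simp only [h1, h2]
  rw [integral_three_sub (hI _ _ _) (hI _ _ _) (hI _ _ _) (hI _ _ _) (hI _ _ _) (hI _ _ _),
    integral_three_sub (hJ _ _) (hJ _ _) (hJ _ _) (hJ _ _) (hJ _ _) (hJ _ _)]
  simp only [integral_poly_mul_pd _ hφ]
  ring

theorem setIntegral_inner_eq_of_support {S Ω : Set E3} (hΩ : MeasurableSet Ω) (hSΩ : S ⊆ Ω)
    (u φ : E3 → E3) (hφ : ∀ x ∉ S, φ x = 0) :
    ∫ x in Ω, inner ℝ (u x) (φ x) = ∫ x in S, inner ℝ (u x) (φ x) := by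
  refine setIntegral_eq_of_subset_of_forall_sdiff_eq_zero hΩ hSΩ fun x hx => ?_
  rw [hφ x hx.2, inner_zero_right]

/-- If `u` is a polynomial field on an open set `S`, then so is its weak curl. -/
theorem HasWeakCurl.eq_polyCurl {Ω S : Set E3} (hΩ : IsOpen Ω) (hS : IsOpen S)
    (hb : Bornology.IsBounded S) (hSΩ : S ⊆ Ω) {u w : L2v Ω} (h : HasWeakCurl u w) {p : VPoly}
    (hp : ∀ᵐ x ∂volume.restrict S, u x = p.val x) :
    ∀ᵐ x ∂volume.restrict S, w x = (polyCurl p).val x := by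
  have hfin : IsFiniteMeasure (volume.restrict S) := ⟨by simpa using hb.measure_lt_top⟩
  have hw : MemLp (w : E3 → E3) 2 (volume.restrict S) :=
    (Lp.memLp w).mono_measure (Measure.restrict_mono hSΩ le_rfl)
  have hq : MemLp (polyCurl p).val 2 (volume.restrict S) := by
    obtain ⟨C, hC⟩ := (hb.isCompact_closure.image
      (VPoly.continuous (polyCurl p))).isBounded.exists_norm_le
    refine MemLp.of_bound (VPoly.continuous _).aestronglyMeasurable C ?_
    filter_upwards [ae_restrict_mem hS.measurableSet] with x hx
    exact hC _ ⟨x, subset_closure hx, rfl⟩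
  -- Both candidates for the curl are in `L²(S)`, so it suffices to test their difference with
  -- fields supported in `S`; for these the integrals over `S`, over `Ω` and over the whole space
  -- coincide.
  have hz : (hw.toLp - hq.toLp : L2v S) = 0 := by
    refine vector_eq_zero hS _ fun φ hφ => ?_
    have hφS : ∀ x ∉ S, φ x = 0 := fun x hx =>
      image_eq_zero_of_notMem_tsupport fun hx' => hx (hφ.supp hx')
    have hcS : ∀ x ∉ S, ccurl φ x = 0 := fun x hx =>
      image_eq_zero_of_notMem_tsupport fun hx' => hx (hφ.ccurl.supp hx')
    have hφΩ : IsTest Ω φ := ⟨hφ.smooth, hφ.compact, hφ.supp.trans hSΩ⟩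
    have e1 : ∫ x in S, inner ℝ (w x) (φ x) = ∫ x in S, inner ℝ ((polyCurl p).val x) (φ x) := by
      rw [← setIntegral_inner_eq_of_support hΩ.measurableSet hSΩ _ _ hφS, h φ hφΩ,
        setIntegral_inner_eq_of_support hΩ.measurableSet hSΩ _ _ hcS,
        ← setIntegral_inner_eq_of_support MeasurableSet.univ (subset_univ S)
          (polyCurl p).val _ hφS, Measure.restrict_univ, ← integral_poly_inner_ccurl p hφ,
        ← setIntegral_univ (f := fun x => inner ℝ (p.val x) (ccurl φ x)),
        setIntegral_inner_eq_of_support MeasurableSet.univ (subset_univ S)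
          p.val _ hcS]
      refine integral_congr_ae ?_
      filter_upwards [hp] with x hx
      rw [hx]
    have i1 := integrable_inner_of_memLp hw.toLp hφ.memLp
    have i2 := integrable_inner_of_memLp hq.toLp hφ.memLp
    have e2 : ∫ x in S, inner ℝ ((hw.toLp : L2v S) x) (φ x) = ∫ x in S, inner ℝ (w x) (φ x) :=
      integral_congr_ae (hw.coeFn_toLp.mono fun x hx => by simp only [hx])
    have e3 : ∫ x in S, inner ℝ ((hq.toLp : L2v S) x) (φ x) = ∫ x in S, inner ℝ ((polyCurl p).val x) (φ x) :=
      integral_congr_ae (hq.coeFn_toLp.mono fun x hx => by simp only [hx])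
    rw [← sub_eq_zero.2 e1, ← e2, ← e3, ← integral_sub i1 i2]
    refine integral_congr_ae ((Lp.coeFn_sub hw.toLp hq.toLp).mono fun x hx => ?_)
    simp only [hx, Pi.sub_apply, inner_sub_left]
  have hz' := sub_eq_zero.1 hz
  filter_upwards [hw.coeFn_toLp, hq.coeFn_toLp] with x h1 h2
  rw [← h1, ← h2, hz']

variable {Ω : Set E3}

theorem Triangulation.mem_cells (T : Triangulation Ω) {K : Finset E3} :
    K ∈ T.cells ↔ K ∈ T.faces ∧ K.card = 4 := by
  simp [Triangulation.cells]

theorem Triangulation.interior_cell_subset (T : Triangulation Ω) {K : Finset E3}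
    (hK : K ∈ T.cells) : interior (convexHull ℝ (K : Set E3)) ⊆ Ω := by
  rw [← T.fills]
  exact interior_mono fun x hx =>
    Geometry.SimplicialComplex.mem_space_iff.2 ⟨K, (T.mem_cells.1 hK).1, hx⟩

theorem isBounded_cell (K : Finset E3) : Bornology.IsBounded (convexHull ℝ (K : Set E3)) :=
  (K.finite_toSet.isCompact_convexHull (𝕜 := ℝ)).isBounded

/-- Properties that hold almost everywhere in the interior of `K` hold almost everywhere on `K`. -/
theorem ae_cell_of_interior (Ω : Set E3) (K : Finset E3) {q : E3 → Prop}
    (h : ∀ᵐ x ∂volume.restrict (interior (convexHull ℝ (K : Set E3))), q x) :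
    ∀ᵐ x ∂volume.restrict Ω, x ∈ convexHull ℝ (K : Set E3) → q x := by
  -- The frontier of a convex set is a null set.
  have h0 : ∀ᵐ x ∂(volume : Measure E3), x ∉ frontier (convexHull ℝ (K : Set E3)) :=
    measure_eq_zero_iff_ae_notMem.1 ((convex_convexHull ℝ _).addHaar_frontier volume)
  refine ae_restrict_of_ae ?_
  filter_upwards [h0, (ae_restrict_iff' isOpen_interior.measurableSet).1 h] with x h1 h2 hx
  refine h2 ?_
  by_contra hn
  exact h1 ⟨subset_closure hx, hn⟩

theorem ae_interior_of_cell (T : Triangulation Ω) {K : Finset E3} (hK : K ∈ T.cells)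
    {q : E3 → Prop} (h : ∀ᵐ x ∂volume.restrict Ω, x ∈ convexHull ℝ (K : Set E3) → q x) :
    ∀ᵐ x ∂volume.restrict (interior (convexHull ℝ (K : Set E3))), q x := by
  filter_upwards [ae_restrict_of_ae_restrict_of_subset (T.interior_cell_subset hK) h,
    ae_restrict_mem isOpen_interior.measurableSet] with x h1 h2
  exact h1 (interior_subset h2)

theorem curl_mem_Udiv (T : Triangulation Ω) (r : ℕ) (u : Ucurl T r) :
    curl (u : L2v Ω) ∈ Udiv T r := by
  have hc := hasCurl0_curl u.2.1
  refine ⟨⟨0, hc.hasDiv0⟩, fun K hK => ?_⟩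
  obtain ⟨p, hp, he⟩ := u.2.2 K hK
  exact ⟨polyCurl p, polyCurl_mem_RTloc hp, ae_cell_of_interior Ω K
    (hc.1.eq_polyCurl T.isOpen isOpen_interior ((isBounded_cell K).subset interior_subset)
      (T.interior_cell_subset hK) (ae_interior_of_cell T hK he))⟩

/-! ### Constant densities -/

theorem Triangulation.isBounded (T : Triangulation Ω) : Bornology.IsBounded Ω := by
  have h : Bornology.IsBounded (⋃ K ∈ T.cells, convexHull ℝ (K : Set E3)) :=
    (Bornology.isBounded_biUnion_finset _).2 fun K _ => isBounded_cell K
  refine h.subset fun x hx => ?_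
  obtain ⟨K, hK, hxK⟩ := T.exists_cell hx
  exact mem_biUnion hK hxK

theorem Triangulation.isFiniteMeasure (T : Triangulation Ω) :
    IsFiniteMeasure (volume.restrict Ω) :=
  ⟨by simpa using T.isBounded.measure_lt_top⟩

/-- Four affinely independent points span `ℝ³`. This nondegeneracy is what makes the polynomial on a
cell unique. -/
theorem Triangulation.interior_cell_nonempty (T : Triangulation Ω) {K : Finset E3}
    (hK : K ∈ T.cells) : (interior (convexHull ℝ (K : Set E3))).Nonempty := by
  obtain ⟨hf, hc⟩ := T.mem_cells.1 hK
  rw [interior_convexHull_nonempty_iff_affineSpan_eq_top]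
  have := (T.indep hf).affineSpan_eq_top_iff_card_eq_finrank_add_one
  rw [Subtype.range_coe] at this
  exact this.2 (by simp [hc])

/-- A nonempty open set contains a box, that is, a product of infinite sets, and such a product
determines a polynomial. -/
theorem Poly.eq_of_eqOn_open {S : Set E3} (hS : IsOpen S) (hne : S.Nonempty) {p q : Poly}
    (h : ∀ x ∈ S, p.val x = q.val x) : p = q := by
  obtain ⟨x, hx⟩ := hne
  obtain ⟨ε, hε, hb⟩ := Metric.isOpen_iff.1
    (hS.preimage (PiLp.continuous_toLp 2 (fun _ : Fin 3 => ℝ))) (WithLp.ofLp x) (by simpa using hx)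
  refine MvPolynomial.funext_set (fun i => Metric.ball (x i) ε) (fun i => ?_) fun y hy => ?_
  · rw [Real.ball_eq_Ioo]
    exact Ioo_infinite (by linarith)
  · have hy' : y ∈ Metric.ball (WithLp.ofLp x) ε := by
      rw [ball_pi _ hε]
      exact hy
    exact h _ (hb hy')

/-- Removes the arbitrary choice in `restr`: continuous functions equal almost everywhere on the
open cell agree there, and then the polynomials are identical. -/
theorem restr_eq (T : Triangulation Ω) {K : Finset E3} (hK : K ∈ T.cells) {f : L2s Ω} {p : Poly}
    (h : EqOnCell f p.val Ω K) : restr f K = p := by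
  have hex : ∃ p : Poly, EqOnCell f (Poly.val p) Ω K := ⟨p, h⟩
  rw [restr, dif_pos hex]
  refine Poly.eq_of_eqOn_open isOpen_interior (T.interior_cell_nonempty hK) fun x hx => ?_
  have hae : hex.choose.val =ᵐ[volume.restrict (interior (convexHull ℝ (K : Set E3)))] p.val := by
    filter_upwards [ae_interior_of_cell T hK hex.choose_spec, ae_interior_of_cell T hK h]
      with x h1 h2
    rw [← h1, h2]
  exact Measure.eqOn_open_of_ae_eq hae isOpen_interior (Poly.continuous _).continuousOn
    p.continuous.continuousOn hx

theorem normal_comm (K L : Finset E3) : normal L K = - normal K L := by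
  classical
  simp only [normal, Finset.inter_comm L K]
  rw [← neg_sub (L.centroid ℝ id) (K.centroid ℝ id), map_neg, norm_neg,
    smul_neg]

theorem one_mem_P (s : ℕ) : (1 : Poly) ∈ P s := by
  rw [P, MvPolynomial.mem_restrictTotalDegree]
  simp

/-- The constant function `1`. -/
def oneFh (T : Triangulation Ω) (s : ℕ) : Fh T s :=
  have := T.isFiniteMeasure
  ⟨(memLp_const (1 : ℝ)).toLp, fun K _ => ⟨1, one_mem_P s, by
    filter_upwards [(memLp_const (p := 2) (μ := volume.restrict Ω) (1 : ℝ)).coeFn_toLp] with x hx _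
    rw [hx]
    simp [Poly.val]⟩⟩

theorem oneFh_ae (T : Triangulation Ω) (s : ℕ) :
    ∀ᵐ x ∂volume.restrict Ω, (oneFh T s : L2s Ω) x = 1 := by
  have := T.isFiniteMeasure
  exact (memLp_const (p := 2) (μ := volume.restrict Ω) (1 : ℝ)).coeFn_toLp

theorem inner_oneFh (T : Triangulation Ω) (s : ℕ) (f : L2s Ω) :
    inner ℝ (oneFh T s : L2s Ω) f = ∫ x in Ω, f x := by
  rw [L2.inner_def]
  refine integral_congr_ae ((oneFh_ae T s).mono fun x hx => ?_)
  simp [hx]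

/-- The gradient of a constant is zero, and its jump is the sum of two opposite unit normals. -/
theorem bh_oneFh (T : Triangulation Ω) (s : ℕ) (g : L2s Ω) (u : L2v Ω) :
    bh T (oneFh T s : L2s Ω) g u = 0 := by
  have h1 : ∀ K ∈ T.cells, restr (oneFh T s : L2s Ω) K = 1 := fun K hK =>
    restr_eq T hK ((oneFh_ae T s).mono fun x hx _ => by simp [hx, Poly.val])
  have hj : ∀ q ∈ facePairs T, ∀ x, jump (oneFh T s : L2s Ω) q.1 q.2 x = 0 := fun q hq x => by
    classical
    obtain ⟨hq1, hq2⟩ := Finset.mem_product.1 (Finset.mem_filter.1 hq).1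
    simp [jump, h1 _ hq1, h1 _ hq2, normal_comm q.1 q.2]
  rw [bh, Finset.sum_eq_zero fun K hK => ?_, Finset.sum_eq_zero fun q hq => ?_]
  · simp
  · simp [hj q hq]
  · simp [h1 K hK, Poly.val]

/-! ### Properties of the discrete operators -/

theorem aform_self (w u : L2v Ω) : aform w u u = 0 := by simp [aform]

theorem crossInner_swap (u v w : L2v Ω) : crossInner w v u = - crossInner u v w := by
  rw [crossInner, crossInner, ← integral_neg]
  refine integral_congr_ae (Filter.Eventually.of_forall fun x => ?_)
  simp only [cross, PiLp.inner_apply, Fin.sum_univ_three]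
  simp
  ring

theorem crossInner_self (u v : L2v Ω) : crossInner u v v = 0 := by
  have h : ∀ x, inner ℝ (cross (u x) (v x)) (v x) = 0 := fun x => by
    simp only [cross, PiLp.inner_apply, Fin.sum_univ_three]
    simp
    ring
  simp [crossInner, h]

theorem inner_piDiv (T : Triangulation Ω) (r : ℕ) (m : L2v Ω) (C : Udiv T r) :
    inner ℝ (piDiv T r m : L2v Ω) (C : L2v Ω) = inner ℝ m (C : L2v Ω) :=
  Submodule.inner_orthogonalProjectionOnto_eq_of_mem_right C m

/-- `⟨curl_h π_h^div m, k⟩ = ⟨m, curl k⟩`. -/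
theorem inner_curlh_piDiv (T : Triangulation Ω) (r : ℕ) (m : L2v Ω) (k : Ucurl T r) :
    inner ℝ (curlh T r (piDiv T r m) : L2v Ω) (k : L2v Ω) = inner ℝ m (curl (k : L2v Ω)) := by
  rw [inner_curlh]
  exact inner_piDiv T r m ⟨_, curl_mem_Udiv T r k⟩

/-- Used to recognise `j` as the weak curl of `B`. -/
theorem curlh_eq (T : Triangulation Ω) (r : ℕ) {b : L2v Ω} {k : Ucurl T r}
    (h : ∀ k' : Ucurl T r, inner ℝ (k : L2v Ω) (k' : L2v Ω) = inner ℝ b (curl (k' : L2v Ω))) :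
    curlh T r b = k :=
  ext_inner_right ℝ fun k' => (inner_curlh T r b k').trans (h k').symm

/-- Two vector potentials with vanishing tangential trace: the curl is symmetric. -/
theorem HasCurl0.inner_comm {a a' b b' : L2v Ω} (h : HasCurl0 a b) (h' : HasCurl0 a' b') :
    inner ℝ a b' = inner ℝ a' b := by
  rw [← h.2 a' b' h'.1, real_inner_comm]

/-! ### Linear potentials and differentiation in time -/

/-- Over a field, the projection of `R` onto its image in `V` splits linearly, and the resulting map
extends from that image to `V`. -/
theorem exists_linear_section {k M V : Type*} [Field k] [AddCommGroup M] [Module k M]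
    [AddCommGroup V] [Module k V] (R : Submodule k (M × V)) :
    ∃ L : V →ₗ[k] M, ∀ b, (∃ a, (a, b) ∈ R) → (L b, b) ∈ R := by
  let g : R →ₗ[k] V := (LinearMap.snd k _ _).comp R.subtype
  obtain ⟨f, hf⟩ := g.rangeRestrict.exists_rightInverse_of_surjective
    (LinearMap.range_rangeRestrict g)
  obtain ⟨L, hL⟩ := LinearMap.exists_extend ((LinearMap.fst k _ _).comp (R.subtype.comp f))
  refine ⟨L, fun b ⟨a, ha⟩ => ?_⟩
  have hb : b ∈ LinearMap.range g := ⟨⟨(a, b), ha⟩, rfl⟩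
  have h1 : L b = (f ⟨b, hb⟩).1.1 := LinearMap.congr_fun hL ⟨b, hb⟩
  have h2 : (f ⟨b, hb⟩).1.2 = b := congrArg Subtype.val (LinearMap.congr_fun hf ⟨b, hb⟩)
  have h3 : ((f ⟨b, hb⟩).1.1, (f ⟨b, hb⟩).1.2) ∈ R := (f ⟨b, hb⟩).2
  rwa [h2, ← h1] at h3

/-- A linear choice of vector potentials. -/
theorem exists_linear_potential (V : Submodule ℝ (L2v Ω)) :
    ∃ L : V →ₗ[ℝ] L2v Ω, ∀ b : V, (∃ a, HasCurl0 a (b : L2v Ω)) → HasCurl0 (L b) (b : L2v Ω) := by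
  obtain ⟨L, hL⟩ := exists_linear_section (mkSubmodule {z : L2v Ω × V | HasCurl0 z.1 (z.2 : L2v Ω)}
    HasCurl0.zero fun a _ _ hf hg => HasCurl0.lin a hf hg)
  exact ⟨L, hL⟩

/-- Product rule for `⟨f, u⟩`, where `f` is only tested against a finite-dimensional space. -/
theorem hasDerivWithinAt_inner_of_forall {H : Type*} [NormedAddCommGroup H]
    [InnerProductSpace ℝ H] {V : Submodule ℝ H} [FiniteDimensional ℝ V] {f : ℝ → H} {u : ℝ → V}
    {f' : V → ℝ} {u' : V} {S : Set ℝ} {t : ℝ}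
    (hf : ∀ v : V, HasDerivWithinAt (fun t' => inner ℝ (f t') (v : H)) (f' v) S t)
    (hu : HasDerivWithinAt u u' S t) :
    HasDerivWithinAt (fun t' => inner ℝ (f t') (u t' : H))
      (f' (u t) + inner ℝ (f t) (u' : H)) S t := by
  let b := stdOrthonormalBasis ℝ V
  have hexp : ∀ (y : H) (v : V), inner ℝ y (v : H) = ∑ i, inner ℝ (b i) v * inner ℝ y (b i : H) := by
    intro y v
    conv_lhs => rw [← b.sum_repr' v]
    simp [inner_sum, real_inner_smul_right]
  have hc : ∀ i, HasDerivWithinAt (fun t' => inner ℝ (b i) (u t' - u t)) (inner ℝ (b i) u') S t :=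
    fun i => by
      have := (innerSL ℝ (b i)).hasFDerivAt.comp_hasDerivWithinAt t (hu.sub_const (u t))
      exact this
  -- Only the increment `u t' - u t` is expanded in the basis. Its coefficients vanish at `t`, so
  -- the terms with `f' (b i)` drop out and no linearity of `f'` is needed.
  have hsum := HasDerivWithinAt.fun_sum (u := Finset.univ) fun i _ => (hc i).mul (hf (b i))
  have h := (hf (u t)).add hsum
  have he : ∀ t', inner ℝ (f t') (u t' : H) = inner ℝ (f t') (u t : H)
      + ∑ i, inner ℝ (b i) (u t' - u t) * inner ℝ (f t') (b i : H) := fun t' => by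
    rw [← hexp (f t') (u t' - u t), ← inner_add_right, Submodule.coe_sub, add_sub_cancel]
  refine (h.congr (fun t' _ => he t') (he t)).congr_deriv ?_
  simp [hexp (f t) u']

theorem hasDerivWithinAt_comp_triple {X Y Z : Type*} [NormedAddCommGroup X] [NormedSpace ℝ X]
    [NormedAddCommGroup Y] [NormedSpace ℝ Y] [NormedAddCommGroup Z] [NormedSpace ℝ Z]
    {l : X × Y × Z → ℝ} {D : X × Y × Z →L[ℝ] ℝ} {x : ℝ → X} {y : ℝ → Y} {z : ℝ → Z}
    {x' : X} {y' : Y} {z' : Z} {S : Set ℝ} {t : ℝ} (hD : HasFDerivAt l D (x t, y t, z t))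
    (hx : HasDerivWithinAt x x' S t) (hy : HasDerivWithinAt y y' S t)
    (hz : HasDerivWithinAt z z' S t) :
    HasDerivWithinAt (fun t' => l (x t', y t', z t')) (D (x', y', z')) S t :=
  hD.comp_hasDerivWithinAt t (hx.prodMk (hy.prodMk hz))

/-! ### The scheme -/

section Scheme

variable {T : Triangulation Ω} {r s : ℕ} {mu lam ν τ : ℝ}
  {lu : State T r s → L2v Ω} {lr : State T r s → L2s Ω} {lB : State T r s → L2v Ω}
  {u w : ℝ → Ugrad T r} {ρ θ : ℝ → Fh T s} {B : ℝ → Udiv T r}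
  {J H U E α j : ℝ → Ucurl T r}

/-- The induction equation holds strongly: `∂ₜB = - curl (E + ν j)`. -/
theorem IsSolution.derivWithin_B
    (h : IsSolution T r s mu lam ν τ lu lr lB u w ρ θ B J H U E α j) {t : ℝ} (ht : t ∈ Icc 0 τ) :
    ((derivWithin B (Icc 0 τ) t : Udiv T r) : L2v Ω)
      = curl ((-(E t + ν • j t) : Ucurl T r) : L2v Ω) := by
  have hlin : curl ((-(E t + ν • j t) : Ucurl T r) : L2v Ω)
      = -(curl (E t : L2v Ω) + ν • curl (j t : L2v Ω)) := by
    change curlU T r _ = -(curlU T r _ + ν • curlU T r _)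
    simp
  -- The residual belongs to the test space because the curl lands in `Udiv`, so it is orthogonal to
  -- itself.
  let Z : Udiv T r := derivWithin B (Icc 0 τ) t - ⟨_, curl_mem_Udiv T r (-(E t + ν • j t))⟩
  have hZ : ∀ C : Udiv T r, inner ℝ (Z : L2v Ω) (C : L2v Ω) = 0 := fun C => by
    have := h.magnetic t ht C
    simp only [Z, Submodule.coe_sub, hlin, inner_sub_left, inner_neg_left, inner_add_left,
      real_inner_smul_left]
    linarith
  have := inner_self_eq_zero.1 (hZ Z)
  exact sub_eq_zero.1 this

theorem IsSolution.hasDerivWithinAt_B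
    (h : IsSolution T r s mu lam ν τ lu lr lB u w ρ θ B J H U E α j) {t : ℝ} (ht : t ∈ Icc 0 τ) :
    HasDerivWithinAt (fun t' => (B t' : L2v Ω))
      (curl ((-(E t + ν • j t) : Ucurl T r) : L2v Ω)) (Icc 0 τ) t := by
  rw [← h.derivWithin_B ht]
  exact (Udiv T r).subtypeL.hasFDerivAt.comp_hasDerivWithinAt t (h.diff_B t ht).hasDerivWithinAt

theorem IsSolution.curlh_B
    (h : IsSolution T r s mu lam ν τ lu lr lB u w ρ θ B J H U E α j) {t : ℝ} (ht : t ∈ Icc 0 τ) :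
    curlh T r (B t : L2v Ω) = j t :=
  curlh_eq T r (h.def_j t ht)

theorem IsSolution.hasWeakDiv_B
    (h : IsSolution T r s mu lam ν τ lu lr lB u w ρ θ B J H U E α j)
    (h0 : HasWeakDiv (B 0 : L2v Ω) 0) {t : ℝ} (ht : t ∈ Icc 0 τ) :
    HasWeakDiv (B t : L2v Ω) 0 := fun φ hφ => by
  have hm := hφ.gradient_memLp
  have he : ∀ v : L2v Ω, ∫ x in Ω, inner ℝ (v x) (gradient φ x) = inner ℝ hm.toLp v := fun v => by
    rw [L2.inner_def]
    exact integral_congr_ae (hm.coeFn_toLp.mono fun x hx => by simp only [hx, real_inner_comm])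
  have hd : ∀ t ∈ Icc 0 τ,
      HasDerivWithinAt (fun t' => inner ℝ hm.toLp (B t' : L2v Ω)) 0 (Icc 0 τ) t := fun t ht => by
    have h1 := (innerSL ℝ hm.toLp).hasFDerivAt.comp_hasDerivWithinAt t (h.hasDerivWithinAt_B ht)
    refine h1.congr_deriv ?_
    have h2 := (hasCurl0_curl (-(E t + ν • j t)).2.1).1.hasWeakDiv φ hφ
    rw [integral_zero_mul, he] at h2
    simpa using h2.symm
  have hτ : 0 ≤ τ := ht.1.trans ht.2
  rw [integral_zero_mul, he]
  -- Derivatives are needed only on `Ico 0 τ`; a point there forces `0 < τ`, which gives unique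
  -- differentiability.
  have hc := constant_of_derivWithin_zero (fun t ht => (hd t ht).differentiableWithinAt)
    (fun t' ht' => (hd t' (Ico_subset_Icc_self ht')).derivWithin
      (uniqueDiffOn_Icc (ht'.1.trans_lt ht'.2) t' (Ico_subset_Icc_self ht'))) t ht
  have hz := h0 φ hφ
  rw [integral_zero_mul, he] at hz
  rw [hc]
  exact hz

theorem IsSolution.hasDerivWithinAt_mass
    (h : IsSolution T r s mu lam ν τ lu lr lB u w ρ θ B J H U E α j) {t : ℝ} (ht : t ∈ Icc 0 τ) :
    HasDerivWithinAt (fun t' => ∫ x in Ω, (ρ t' : L2s Ω) x) 0 (Icc 0 τ) t := by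
  simp only [← inner_oneFh T s]
  have h1 := ((innerSL ℝ (oneFh T s : L2s Ω)).comp
    (Fh T s).subtypeL).hasFDerivAt.comp_hasDerivWithinAt t (h.diff_ρ t ht).hasDerivWithinAt
  refine h1.congr_deriv ?_
  have h2 := h.density t ht (oneFh T s)
  rw [bh_oneFh, add_zero, real_inner_comm] at h2
  exact h2

theorem IsSolution.hasDerivWithinAt_energy
    (h : IsSolution T r s mu lam ν τ lu lr lB u w ρ θ B J H U E α j) {l : State T r s → ℝ} {t : ℝ}
    (ht : t ∈ Icc 0 τ)
    (hl : HasVarDeriv l (u t, ρ t, B t) (lu (u t, ρ t, B t)) (lr (u t, ρ t, B t))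
      (lB (u t, ρ t, B t))) :
    HasDerivWithinAt
      (fun t' => inner ℝ (lu (u t', ρ t', B t')) (u t' : L2v Ω) - l (u t', ρ t', B t'))
      (dform mu lam (u t : L2v Ω) (u t : L2v Ω)
        - eh T r ν (B t) (piDiv T r (lB (u t, ρ t, B t)))) (Icc 0 τ) t := by
  obtain ⟨D, hD, hDe⟩ := hl
  have hu := (h.diff_u t ht).hasDerivWithinAt
  have hρ := (h.diff_ρ t ht).hasDerivWithinAt
  have hB := (h.diff_B t ht).hasDerivWithinAt
  have h1 := hasDerivWithinAt_inner_of_forall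
    (fun v => (h.diff_lu v t ht).hasDerivWithinAt) hu
  have h2 := hasDerivWithinAt_comp_triple hD hu hρ hB
  refine (h1.sub h2).congr_deriv ?_
  rw [hDe, h.derivWithin_B ht]
  -- Test functions: `u` in the momentum equation, `θ` in the continuity equation, `∂ₜρ` in the
  -- definition of `θ`, and `-(E + ν j)` in that of `J`.
  have hvel := h.velocity t ht (u t)
  have hden := h.density t ht (θ t)
  rw [aform_self] at hvel
  have hθ := h.def_θ t ht (derivWithin ρ (Icc 0 τ) t)
  rw [real_inner_comm] at hθ
  have hJ := h.def_J t ht (-(E t + ν • j t))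
  -- Since `α` lies in the Nédélec space, `u` may be replaced by its projection `U`, which is a
  -- legitimate test field for `α`.
  have hα : inner ℝ (α t : L2v Ω) (u t : L2v Ω)
      = - crossInner (J t : L2v Ω) (H t : L2v Ω) (U t : L2v Ω) := by
    rw [real_inner_comm, ← h.def_U t ht (α t), real_inner_comm]
    exact h.def_α t ht (U t)
  have hE := h.def_E t ht (J t)
  rw [crossInner_swap] at hE
  -- The projector is invisible here, because curls of Nédélec fields already lie in the
  -- Raviart–Thomas space.
  have hcurl : curlh T r (piDiv T r (lB (u t, ρ t, B t)) : L2v Ω) = -J t :=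
    ext_inner_right ℝ fun k => by
      refine (inner_curlh_piDiv T r _ k).trans ?_
      rw [inner_neg_left, ← neg_eq_iff_eq_neg, ← h.def_J t ht k]
      rfl
  rw [eh, hcurl, h.curlh_B ht]
  simp only [Submodule.coe_neg, Submodule.coe_add, Submodule.coe_smul, inner_neg_right,
    inner_add_right, real_inner_smul_right, real_inner_comm (J t : L2v Ω)] at hJ hE ⊢
  linarith

theorem IsSolution.hasDerivWithinAt_helicity
    (h : IsSolution T r s mu lam ν τ lu lr lB u w ρ θ B J H U E α j) {A : ℝ → L2v Ω}
    (hA : ∀ t ∈ Icc 0 τ, HasCurl0 (A t) (B t : L2v Ω)) {t : ℝ} (ht : t ∈ Icc 0 τ) :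
    HasDerivWithinAt (fun t' => ∫ x in Ω, inner ℝ (A t' x) ((B t' : L2v Ω) x))
      (2 * eh T r ν (B t) (piDiv T r (A t))) (Icc 0 τ) t := by
  -- `A` may be arbitrarily irregular in time, so a linear potential `L B` is differentiated
  -- instead; `L` is continuous since `Udiv` is finite-dimensional.
  obtain ⟨L, hL⟩ := exists_linear_potential (Udiv T r)
  have hLB : ∀ t ∈ Icc 0 τ, HasCurl0 (L (B t)) (B t : L2v Ω) := fun t ht => hL _ ⟨_, hA t ht⟩
  have hLd := (LinearMap.toContinuousLinearMap L).hasFDerivAt.comp_hasDerivWithinAt t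
    (h.diff_B t ht).hasDerivWithinAt
  have hd := hLd.inner ℝ (h.hasDerivWithinAt_B ht)
  refine (hd.congr_deriv ?_).congr_of_mem (fun t' ht' => ?_) ht
  · have hF := hasCurl0_curl (-(E t + ν • j t)).2.1
    -- The time derivative `∂ₜB` has the potential `-(E + ν j)`, so `L` is a valid potential there
    -- too.
    have hLF : HasCurl0 (L (derivWithin B (Icc 0 τ) t))
        ((derivWithin B (Icc 0 τ) t : Udiv T r) : L2v Ω) :=
      hL _ ⟨_, h.derivWithin_B ht ▸ hF⟩
    have e1 := hLF.inner_comm (hLB t ht)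
    have e2 := (hLB t ht).inner_comm hF
    have e3 := (hA t ht).inner_comm (hasCurl0_curl (j t).2.1)
    -- Replacing `B` by its Nédélec projection `H` is what makes the triple product degenerate.
    have hE : inner ℝ (E t : L2v Ω) (B t : L2v Ω) = 0 := by
      rw [real_inner_comm, ← h.def_H t ht (E t), real_inner_comm, h.def_E t ht (H t),
        crossInner_self, neg_zero]
    have hj := inner_curlh_piDiv T r (A t) (j t)
    rw [eh, h.curlh_B ht, real_inner_comm (curlh T r _ : L2v Ω), hj, e3]
    rw [h.derivWithin_B ht] at e1
    change inner ℝ (L (B t)) _ + inner ℝ (L (derivWithin B (Icc 0 τ) t)) (B t : L2v Ω) = _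
    rw [e1, e2]
    simp only [Submodule.coe_neg, Submodule.coe_add, Submodule.coe_smul, inner_neg_left,
      inner_add_left, real_inner_smul_left, hE]
    ring
  · change _ = inner ℝ (L (B t')) (B t' : L2v Ω)
    rw [(hLB t' ht').inner_comm (hA t' ht'), L2.inner_def]

end Scheme

end MHD

end

theorem proposition1 {Ω : Set MHD.E3} (T : MHD.Triangulation Ω) (r s : ℕ)
    (mu lam ν τ : ℝ) (hτ : 0 < τ)
    -- the Lagrangian and its variational derivatives on a set `𝒟` of admissible states
    (𝒟 : Set (MHD.State T r s)) (l : MHD.State T r s → ℝ)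
    (lu : MHD.State T r s → MHD.L2v Ω) (lr : MHD.State T r s → MHD.L2s Ω)
    (lB : MHD.State T r s → MHD.L2v Ω)
    (hl : ∀ x ∈ 𝒟, MHD.HasVarDeriv l x (lu x) (lr x) (lB x))
    -- a solution of the scheme
    (u w : ℝ → MHD.Ugrad T r) (ρ θ : ℝ → MHD.Fh T s) (B : ℝ → MHD.Udiv T r)
    (J H U E α j : ℝ → MHD.Ucurl T r)
    (hadm : ∀ t ∈ Set.Icc 0 τ, (u t, ρ t, B t) ∈ 𝒟)
    (hsol : MHD.IsSolution T r s mu lam ν τ lu lr lB u w ρ θ B J H U E α j)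
    -- the initial magnetic field is divergence-free
    (hB0 : MHD.HasWeakDiv (B 0 : MHD.L2v Ω) 0) :
    -- the magnetic field stays divergence-free
    (∀ t ∈ Set.Icc 0 τ, MHD.HasWeakDiv (B t : MHD.L2v Ω) 0) ∧
    -- conservation of total mass
    (∀ t ∈ Set.Icc 0 τ,
      HasDerivWithinAt (fun t' => ∫ x in Ω, (ρ t' : MHD.L2s Ω) x) 0 (Set.Icc 0 τ) t) ∧
    -- balance of energy
    (∀ t ∈ Set.Icc 0 τ,
      HasDerivWithinAt
        (fun t' => inner ℝ (lu (u t', ρ t', B t')) (u t' : MHD.L2v Ω) - l (u t', ρ t', B t'))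
        (MHD.dform mu lam (u t : MHD.L2v Ω) (u t : MHD.L2v Ω)
          - MHD.eh T r ν (B t) (MHD.piDiv T r (lB (u t, ρ t, B t))))
        (Set.Icc 0 τ) t) ∧
    -- balance of magnetic helicity, for every vector potential with vanishing tangential trace
    (∀ A : ℝ → MHD.L2v Ω, (∀ t ∈ Set.Icc 0 τ, MHD.HasCurl0 (A t) (B t : MHD.L2v Ω)) →
      ∀ t ∈ Set.Icc 0 τ,
        HasDerivWithinAt
          (fun t' => ∫ x in Ω, inner ℝ ((A t' : MHD.L2v Ω) x) ((B t' : MHD.L2v Ω) x))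
          (2 * MHD.eh T r ν (B t) (MHD.piDiv T r (A t)))
          (Set.Icc 0 τ) t) := by
  exact ⟨fun t ht => hsol.hasWeakDiv_B hB0 ht, fun t ht => hsol.hasDerivWithinAt_mass ht,
    fun t ht => hsol.hasDerivWithinAt_energy ht (hl _ (hadm t ht)),
    fun A hA t ht => hsol.hasDerivWithinAt_helicity hA ht⟩
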